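/- For a positive integer $k$, a $k$-colored nonnegative integer is a nonnegative integer $j$ carrying one of the colors $1,\dots,k$, written $j_c$; colored integers are ordered by $0_1\prec 0_2\prec\cdots\prec 0_k\prec 1_1\prec 1_2\prec\cdots\prec 1_k\prec 2_1\prec\cdots$. A $k$-colored generalized Frobenius partition of $n$ is a two-row array $\begin{pmatrix}a_1,a_2,\dots,a_r\\ b_1,b_2,\dots,b_r\end{pmatrix}$ ($r\ge 0$) of $k$-colored nonnegative integers with $a_r\prec a_{r-1}\prec\cdots\prec a_1$, $b_r\prec b_{r-1}\prec\cdots\prec b_1$ and $n=r+\sum_{i=1}^r(a_i+b_i)$ (where in the sum the colors are ignored). Let $c\phi_k(n)$ be the number of $k$-colored generalized Frobenius partitions of $n$. Theorem. For all integers $k\ge 3$ and $n\ge 0$, \begin{align*} c\phi_{9}\Big(3^{2k+1}n+\frac{7\cdot 3^{2k+1}+3}{8}\Big) &\equiv 0 \pmod{3^{4k+5}},\\ c\phi_{9}\Big(3^{2k+2}n+\frac{5\cdot 3^{2k+2}+3}{8}\Big) &\equiv 0 \pmod{3^{4k+6}},\\ c\phi_{9}\Big(3^{2k+2}n+\frac{23\cdot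 3^{2k+1}+3}{8}\Big) &\equiv 0 \pmod{3^{4k+7}},\\ c\phi_{9}\Big(3^{2k+3}n+\frac{13\cdot 3^{2k+2}+3}{8}\Big) &\equiv 0 \pmod{3^{4k+8}}. \end{align*} -/

import Mathlib

/-- A `k`-colored nonnegative integer: its value in `ℕ` together with one of `k` colors.
The lexicographic order compares values first and colors second, that is
`0_1 ≺ 0_2 ≺ ⋯ ≺ 0_k ≺ 1_1 ≺ ⋯ ≺ 1_k ≺ 2_1 ≺ ⋯`. -/
abbrev ColoredNat (k : ℕ) : Type := ℕ ×ₗ Fin k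

/-- The integer underlying a colored integer. -/
def ColoredNat.value {k : ℕ} (a : ColoredNat k) : ℕ := (ofLex a).1

/-- A `k`-colored generalized Frobenius partition: a two-row array of `k`-colored nonnegative
integers, both rows of the same length and strictly decreasing for `≺`. -/
@[ext] structure ColoredFrobeniusPartition (k : ℕ) where
  /-- The row `a₁, …, aᵣ`. -/
  top : List (ColoredNat k)
  /-- The row `b₁, …, bᵣ`. -/
  bottom : List (ColoredNat k)
  length_eq : top.length = bottom.length
  top_decreasing : top.Pairwise (· > ·)
  bottom_decreasing : bottom.Pairwise (· > ·)

/-- The number being partitioned, `r + ∑ (aᵢ + bᵢ)`. -/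
def ColoredFrobeniusPartition.size {k : ℕ} (F : ColoredFrobeniusPartition k) : ℕ :=
  F.top.length + ((F.top.map ColoredNat.value).sum + (F.bottom.map ColoredNat.value).sum)

/-- `cphi k n` is the number of `k`-colored generalized Frobenius partitions of `n`. -/
noncomputable def cphi (k n : ℕ) : ℕ :=
  Nat.card {F : ColoredFrobeniusPartition k // F.size = n}

/-- There are only finitely many `k`-colored generalized Frobenius partitions of `n`, so that
`cphi` really counts them. -/
theorem finite_coloredFrobeniusPartition (k n : ℕ) :
    Finite {F : ColoredFrobeniusPartition k // F.size = n} := by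
  classical
  let S : Finset (ColoredNat k) :=
    (Finset.range (n + 1) ×ˢ (Finset.univ : Finset (Fin k))).map toLex.toEmbedding
  have hS : ∀ l : List (ColoredNat k), (l.map ColoredNat.value).sum ≤ n →
      l.toFinset ∈ S.powerset := by
    intro l hl
    rw [Finset.mem_powerset]
    intro a ha
    have h1 : a.value ∈ l.map ColoredNat.value :=
      List.mem_map_of_mem (List.mem_toFinset.1 ha)
    have h2 : a.value ≤ n := (List.le_sum_of_mem h1).trans hl
    refine Finset.mem_map.2 ⟨ofLex a, ?_, rfl⟩
    simp only [Finset.mem_product, Finset.mem_range, Finset.mem_univ, and_true]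
    exact Nat.lt_succ_of_le h2
  have hinj : ∀ l m : List (ColoredNat k), l.Pairwise (· > ·) → m.Pairwise (· > ·) →
      l.toFinset = m.toFinset → l = m := by
    intro l m hl hm h
    exact (List.perm_of_nodup_nodup_toFinset_eq (hl.imp ne_of_gt) (hm.imp ne_of_gt)
      h).eq_of_pairwise (fun a b _ _ h1 h2 => absurd h1 (not_lt_of_gt h2)) hl hm
  have ht : ∀ F : {F : ColoredFrobeniusPartition k // F.size = n},
      (F.1.top.map ColoredNat.value).sum ≤ n := by
    intro F
    have h := F.2
    unfold ColoredFrobeniusPartition.size at h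
    omega
  have hb : ∀ F : {F : ColoredFrobeniusPartition k // F.size = n},
      (F.1.bottom.map ColoredNat.value).sum ≤ n := by
    intro F
    have h := F.2
    unfold ColoredFrobeniusPartition.size at h
    omega
  let f : {F : ColoredFrobeniusPartition k // F.size = n} → S.powerset × S.powerset :=
    fun F => (⟨F.1.top.toFinset, hS _ (ht F)⟩, ⟨F.1.bottom.toFinset, hS _ (hb F)⟩)
  refine Finite.of_injective f ?_
  intro F G h
  have h1 : F.1.top.toFinset = G.1.top.toFinset := congrArg (fun p => p.1.1) h
  have h2 : F.1.bottom.toFinset = G.1.bottom.toFinset := congrArg (fun p => p.2.1) h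
  exact Subtype.ext (ColoredFrobeniusPartition.ext
    (hinj _ _ F.1.top_decreasing G.1.top_decreasing h1)
    (hinj _ _ F.1.bottom_decreasing G.1.bottom_decreasing h2))

/-! Write a(q), b(q), c(q) for the cubic theta functions: `hexTheta`, `borweinB`, and
`hexCosetTheta` with its factor q^(1/3) dropped. By the triple product, ∑ cφ₉(n) qⁿ is the constant
term in z of θ(z)⁹ divided by ∏(1 - qⁱ)⁹ (`euler_pow_mul_cphiSeries`). Splitting ℤ³ by the
coordinate sum expresses θ³ through a and c (`theta_pow_three`), and cubing again evaluates that
constant term (`constTerm_theta_pow_nine`).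

Put x = a(q³) and y = q c(q³). Then a = x + 2y and b = x - y, and the Borwein identity a³ = b³ + c³
holds (`hexTheta_pow_three`). With r = c³/b³ and Q = x² + xy + y², one has 1/b = Q / b(q³)³, so r
equals 9yQ⁴ times a series in q³. A product a b⁻ᵉ rⁱ is thus 9ⁱ times a series in q³ times a binary
form in x and y. Picking out exponents in one residue class mod 3 keeps the monomials whose y-degree
lies in that class; replacing q³ by q turns x, y³ into a, qc³, and a³ = b³(1 + r), qc³ = b³r recover
a fixed multiplier times an integral polynomial in r. Every surviving c is moreover divisible by 3.

Three multipliers H, G, K close up under these operators: the series of cφ₉(3n) lies in H ℤ[r], and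
the steps H → G, G → K, K → G gain 27, 81 and 3 (`trisect_two_of_mem_multH`,
`trisect_two_of_mem_multG`, `trisect_one_of_mem_multK`). Each double step gains 3⁵, which outruns
the required 3⁴. The last two congruences leave the cycle through another residue class, where one
further factor 9 appears. -/

open PowerSeries

/-! ### Generating functions of weighted index sets -/

/-- The substitution `X ↦ X ^ 3` on power series. -/
noncomputable abbrev dilate {K : Type*} [CommRing K] : K⟦X⟧ →ₐ[K] K⟦X⟧ :=
  PowerSeries.expand 3 three_ne_zero

/-- A weight on `ι` all of whose level sets are finite. -/
def FinFib {ι : Type*} (f : ι → ℕ) : Prop := ∀ N, {i | f i = N}.Finite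

/-- The generating function `∑ i, v i * X ^ f i`. -/
noncomputable def gf {K ι : Type*} [CommRing K] (f : ι → ℕ) (v : ι → K) : K⟦X⟧ :=
  PowerSeries.mk fun N => ∑ᶠ i ∈ {i | f i = N}, v i

section gf

variable {K L ι κ : Type*} [CommRing K] [CommRing L]

theorem FinFib.comp {f : ι → ℕ} (hf : FinFib f) {e : κ → ι} (he : e.Injective) :
    FinFib (f ∘ e) := fun N => (hf N).preimage he.injOn

theorem FinFib.of_bound {f : ι → ℕ} {g : κ → ℕ} (hf : FinFib f) (e : κ → ι)
    (he : e.Injective) (c : ℕ) (h : ∀ i, f (e i) ≤ g i + c) : FinFib g := by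
  intro N
  have : (⋃ M ∈ Finset.range (N + c + 1), {i | f i = M}).Finite :=
    Set.Finite.biUnion (Finset.finite_toSet _) fun M _ => hf M
  refine (this.preimage (f := e) he.injOn).subset fun i hi => ?_
  have h1 := h i
  simp only [Set.mem_ofPred_eq] at hi
  simp only [Set.mem_preimage, Set.mem_iUnion, Set.mem_ofPred_eq, Finset.mem_range,
    exists_prop, exists_eq_right']
  omega

theorem FinFib.prod {f : ι → ℕ} {g : κ → ℕ} (hf : FinFib f) (hg : FinFib g) :
    FinFib fun p : ι × κ => f p.1 + g p.2 := by
  intro N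
  have h1 : (⋃ M ∈ Finset.range (N + 1), {i | f i = M}).Finite :=
    Set.Finite.biUnion (Finset.finite_toSet _) fun M _ => hf M
  have h2 : (⋃ M ∈ Finset.range (N + 1), {i | g i = M}).Finite :=
    Set.Finite.biUnion (Finset.finite_toSet _) fun M _ => hg M
  refine (h1.prod h2).subset fun p hp => ?_
  simp only [Set.mem_ofPred_eq] at hp
  simp only [Set.mem_prod, Set.mem_iUnion, Set.mem_ofPred_eq, Finset.mem_range,
    exists_prop, exists_eq_right']
  omega

theorem coeff_gf (f : ι → ℕ) (v : ι → K) (N : ℕ) :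
    coeff N (gf f v) = ∑ᶠ i ∈ {i | f i = N}, v i := coeff_mk _ _

theorem coeff_gf_of_finFib {f : ι → ℕ} (hf : FinFib f) (v : ι → K) (N : ℕ) :
    coeff N (gf f v) = ∑ i ∈ (hf N).toFinset, v i := by
  rw [coeff_gf, finsum_mem_eq_finite_toFinset_sum _ (hf N)]

theorem gf_eq_of_bijective {f : ι → ℕ} {g : κ → ℕ} {v : ι → K} {w : κ → K} (e : κ → ι)
    (he : e.Bijective) (h : ∀ i, f (e i) = g i) (hv : ∀ i, v (e i) = w i) :
    gf f v = gf g w := by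
  ext N
  rw [coeff_gf, coeff_gf]
  refine (finsum_eq_of_bijective e he fun i => ?_).symm
  simp only [Set.mem_ofPred_eq, h, hv]

theorem gf_mul {f : ι → ℕ} {g : κ → ℕ} (hf : FinFib f) (hg : FinFib g) (v : ι → K)
    (w : κ → K) :
    gf f v * gf g w = gf (fun p : ι × κ => f p.1 + g p.2) fun p => v p.1 * w p.2 := by
  classical
  ext N
  rw [coeff_mul, coeff_gf_of_finFib (hf.prod hg)]
  simp_rw [coeff_gf_of_finFib hf, coeff_gf_of_finFib hg, Finset.sum_mul_sum,
    ← Finset.sum_product']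
  rw [Finset.sum_sigma']
  refine Finset.sum_bij' (fun x _ => x.2) (fun p _ => ⟨(f p.1, g p.2), p⟩) ?_ ?_ ?_ ?_ ?_
  · rintro ⟨⟨a, b⟩, i, j⟩ h
    simp at h ⊢
    omega
  · rintro ⟨i, j⟩ h
    simpa using h
  · rintro ⟨⟨a, b⟩, i, j⟩ h
    simp at h ⊢
    exact h.2
  · rintro ⟨i, j⟩ h
    rfl
  · rintro ⟨⟨a, b⟩, i, j⟩ h
    rfl

theorem gf_sum {f : ι ⊕ κ → ℕ} (hf : FinFib f) (v : ι ⊕ κ → K) :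
    gf f v = gf (fun i => f (.inl i)) (fun i => v (.inl i))
      + gf (fun i => f (.inr i)) fun i => v (.inr i) := by
  have hl : FinFib fun i => f (.inl i) := hf.comp Sum.inl_injective
  have hr : FinFib fun i => f (.inr i) := hf.comp Sum.inr_injective
  ext N
  rw [map_add, coeff_gf_of_finFib hf, coeff_gf_of_finFib hl, coeff_gf_of_finFib hr,
    ← Finset.sum_disjSum]
  refine Finset.sum_congr ?_ fun _ _ => rfl
  ext (i | i) <;> simp

theorem gf_three_of_bijective {ι₁ ι₂ ι₃ : Type*} {f : ι → ℕ} (hf : FinFib f) {v : ι → K}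
    (e₁ : ι₁ → ι) (e₂ : ι₂ → ι) (e₃ : ι₃ → ι)
    (he : (Sum.elim e₁ (Sum.elim e₂ e₃)).Bijective) :
    gf f v = gf (fun i => f (e₁ i)) (fun i => v (e₁ i))
      + (gf (fun i => f (e₂ i)) (fun i => v (e₂ i))
        + gf (fun i => f (e₃ i)) fun i => v (e₃ i)) := by
  have h : FinFib (f ∘ Sum.elim e₁ (Sum.elim e₂ e₃)) := hf.comp he.injective
  rw [gf_eq_of_bijective (g := f ∘ Sum.elim e₁ (Sum.elim e₂ e₃))
    (w := v ∘ Sum.elim e₁ (Sum.elim e₂ e₃)) _ he (fun _ => rfl) (fun _ => rfl), gf_sum h]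
  exact congrArg _ (gf_sum (h.comp Sum.inr_injective) _)

theorem gf_add_const (f : ι → ℕ) (c : ℕ) (v : ι → K) :
    gf (fun i => f i + c) v = X ^ c * gf f v := by
  ext N
  rw [coeff_X_pow_mul', coeff_gf]
  split_ifs with h
  · rw [coeff_gf]
    refine finsum_congr fun i => finsum_congr_Prop ?_ fun _ => rfl
    simp only [Set.mem_ofPred_eq, eq_iff_iff]
    omega
  · have : {i | f i + c = N} = ∅ := by
      ext i; simp only [Set.mem_ofPred_eq, Set.mem_empty_iff_false, iff_false]; omega
    rw [this, finsum_mem_empty]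

theorem gf_const_mul {f : ι → ℕ} (hf : FinFib f) (a : K) (v : ι → K) :
    gf f (fun i => a * v i) = C a * gf f v := by
  ext N
  rw [coeff_C_mul, coeff_gf_of_finFib hf, coeff_gf_of_finFib hf, Finset.mul_sum]

theorem gf_three_mul (f : ι → ℕ) (v : ι → K) :
    gf (fun i => 3 * f i) v = dilate (gf f v) := by
  ext N
  rw [coeff_expand]
  split_ifs with h
  · obtain ⟨m, rfl⟩ := h
    rw [coeff_gf, coeff_gf]
    refine finsum_congr fun i => finsum_congr_Prop ?_ fun _ => rfl
    simp only [Set.mem_ofPred_eq, eq_iff_iff]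
    omega
  · have : {i | 3 * f i = N} = ∅ := by
      ext i; simp only [Set.mem_ofPred_eq, Set.mem_empty_iff_false, iff_false]; omega
    rw [coeff_gf, this, finsum_mem_empty]

theorem map_gf {f : ι → ℕ} (hf : FinFib f) (r : K →+* L) (v : ι → K) :
    PowerSeries.map r (gf f v) = gf f fun i => r (v i) := by
  ext N
  rw [coeff_map, coeff_gf_of_finFib hf, coeff_gf_of_finFib hf, map_sum]

end gf

/-! ### Quadratic weights and the finiteness of their level sets -/

section weights

/-- The triangular number `n (n + 1) / 2`. -/
def tri (n : ℤ) : ℕ := (n * (n + 1) / 2).toNat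

/-- The pentagonal number `n (3 n + 1) / 2`. -/
def pent (n : ℤ) : ℕ := (n * (3 * n + 1) / 2).toNat

/-- The norm form of the hexagonal lattice. -/
def hexForm (p : ℤ × ℤ) : ℕ := (p.1 ^ 2 + p.1 * p.2 + p.2 ^ 2).toNat

/-- The norm form of the hexagonal lattice on the coset of a deep hole. -/
def hexCoset (p : ℤ × ℤ) : ℕ := (p.1 ^ 2 + p.1 * p.2 + p.2 ^ 2 + p.1 + p.2).toNat

theorem two_mul_tri (n : ℤ) : 2 * (tri n : ℤ) = n * (n + 1) := by
  have h : 0 ≤ n * (n + 1) := by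
    rcases le_or_gt 0 n with h | h
    · positivity
    · nlinarith
  obtain ⟨k, hk⟩ := Int.even_mul_succ_self n
  unfold tri
  rw [Int.toNat_of_nonneg (Int.ediv_nonneg h zero_le_two)]
  omega

theorem two_mul_pent (n : ℤ) : 2 * (pent n : ℤ) = n * (3 * n + 1) := by
  have h : 0 ≤ n * (3 * n + 1) := by
    rcases le_or_gt 0 n with h | h
    · positivity
    · nlinarith
  obtain ⟨k, hk⟩ := Int.even_mul_succ_self n
  have h2 : n * (3 * n + 1) = 2 * (k + n ^ 2) := by linear_combination hk
  unfold pent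
  rw [Int.toNat_of_nonneg (Int.ediv_nonneg h zero_le_two), h2]
  omega

theorem cast_hexForm (p : ℤ × ℤ) : (hexForm p : ℤ) = p.1 ^ 2 + p.1 * p.2 + p.2 ^ 2 :=
  Int.toNat_of_nonneg (by nlinarith [sq_nonneg (p.1 + p.2), sq_nonneg p.1, sq_nonneg p.2])

theorem cast_hexCoset (p : ℤ × ℤ) :
    (hexCoset p : ℤ) = p.1 ^ 2 + p.1 * p.2 + p.2 ^ 2 + p.1 + p.2 := by
  refine Int.toNat_of_nonneg ?_
  have h1 := two_mul_tri p.1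
  have h2 := two_mul_tri p.2
  have h3 := two_mul_tri (p.1 + p.2)
  have : (0 : ℤ) ≤ tri p.1 + tri p.2 + tri (p.1 + p.2) := by positivity
  linarith

theorem le_two_mul_tri (n : ℤ) : |n| ≤ 2 * tri n + 1 := by
  rw [two_mul_tri]
  rcases le_or_gt 0 n with h | h
  · rw [abs_of_nonneg h]; nlinarith
  · rw [abs_of_neg h]; nlinarith

theorem finFib_tri : FinFib tri := by
  intro N
  refine (Set.finite_Icc (-(2 * N + 1 : ℤ)) (2 * N + 1)).subset fun n hn => ?_
  have h := le_two_mul_tri n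
  rw [Set.mem_ofPred_eq] at hn
  rw [hn, abs_le] at h
  exact h

theorem finFib_pent : FinFib pent := by
  refine finFib_tri.of_bound id Function.injective_id 0 fun n => ?_
  have h1 := two_mul_tri n
  have h2 := two_mul_pent n
  have h3 := sq_nonneg n
  simp only [id, add_zero]
  zify
  linarith

theorem finFib_hexForm : FinFib hexForm := by
  refine (finFib_tri.prod finFib_tri).of_bound id Function.injective_id 0 fun p => ?_
  have h1 := two_mul_tri p.1
  have h2 := two_mul_tri p.2
  have h3 := two_mul_tri (-(p.1 + p.2))
  have h4 := cast_hexForm p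
  simp only [id, add_zero]
  zify
  have : (0 : ℤ) ≤ tri (-(p.1 + p.2)) := by positivity
  linarith

theorem finFib_hexCoset : FinFib hexCoset := by
  refine (finFib_tri.prod finFib_tri).of_bound id Function.injective_id 0 fun p => ?_
  have h1 := two_mul_tri p.1
  have h2 := two_mul_tri p.2
  have h3 := two_mul_tri (p.1 + p.2)
  have h4 := cast_hexCoset p
  simp only [id, add_zero]
  zify
  have : (0 : ℤ) ≤ tri (p.1 + p.2) := by positivity
  linarith

theorem FinFib.const_mul {ι : Type*} {f : ι → ℕ} (hf : FinFib f) {c : ℕ} (hc : 0 < c) :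
    FinFib fun i => c * f i :=
  hf.of_bound id Function.injective_id 0 fun i => by
    simpa using Nat.le_mul_of_pos_left (f i) hc

theorem finFib_pent_neg : FinFib fun u => pent (-u - 1) :=
  finFib_pent.comp (e := fun u => -u - 1) fun a b h => by simpa using h

end weights

/-! ### Jacobi's theta series over an arbitrary ring, and its cube -/

section theta

variable {K : Type*} [CommRing K]

/-- Jacobi's theta series `∑ zⁿ X^(n (n + 1) / 2)`. -/
noncomputable def theta (z : Kˣ) : K⟦X⟧ := gf tri fun n => ((z ^ n : Kˣ) : K)

/-- The theta series of the hexagonal lattice. -/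
noncomputable def hexTheta (K : Type*) [CommRing K] : K⟦X⟧ := gf hexForm fun _ => 1

/-- The theta series of a coset of the hexagonal lattice, without its fractional power. -/
noncomputable def hexCosetTheta (K : Type*) [CommRing K] : K⟦X⟧ := gf hexCoset fun _ => 1

/-- The three parts play a double role: they are the coefficients of the hexagonal theta series in
θ³, and, after dilation and up to a monomial factor, the residue classes mod 3 of θ itself.
Comparing the two roles eliminates parts 1 and 2. -/
noncomputable def thetaPart₀ (z : Kˣ) : K⟦X⟧ :=
  gf (fun u => 3 * tri u) fun u => ((z ^ (3 * u) : Kˣ) : K)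

noncomputable def thetaPart₁ (z : Kˣ) : K⟦X⟧ :=
  gf (fun u => pent (-u - 1)) fun u => ((z ^ (3 * u + 1) : Kˣ) : K)

noncomputable def thetaPart₂ (z : Kˣ) : K⟦X⟧ :=
  gf pent fun u => ((z ^ (3 * u - 1) : Kˣ) : K)

theorem map_hexTheta {L : Type*} [CommRing L] (r : K →+* L) :
    PowerSeries.map r (hexTheta K) = hexTheta L := by
  simp [hexTheta, map_gf finFib_hexForm]

theorem map_hexCosetTheta {L : Type*} [CommRing L] (r : K →+* L) :
    PowerSeries.map r (hexCosetTheta K) = hexCosetTheta L := by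
  simp [hexCosetTheta, map_gf finFib_hexCoset]

/-- Triples of integers are sorted by their sum 3u, 3u + 1 or 3u - 1. The power of z depends only on
this sum; the deviation from the centre runs over the hexagonal lattice in the first case and over a
deep-hole coset in the other two. -/
theorem theta_pow_three (z : Kˣ) :
    theta z ^ 3 = thetaPart₀ z * hexTheta K
      + (thetaPart₁ z * hexCosetTheta K + thetaPart₂ z * hexCosetTheta K) := by
  have hf := finFib_tri.prod (finFib_tri.prod finFib_tri)
  rw [pow_three, theta, gf_mul finFib_tri finFib_tri,
    gf_mul finFib_tri (finFib_tri.prod finFib_tri),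
    gf_three_of_bijective hf
      (fun p : ℤ × ℤ × ℤ => (p.1 + p.2.1, p.1 + p.2.2, p.1 - p.2.1 - p.2.2))
      (fun p : ℤ × ℤ × ℤ => (p.1 - p.2.1, p.1 - p.2.2, p.1 + 1 + p.2.1 + p.2.2))
      (fun p : ℤ × ℤ × ℤ => (p.1 + p.2.1, p.1 + p.2.2, p.1 - 1 - p.2.1 - p.2.2)),
    thetaPart₀, hexTheta, gf_mul (finFib_tri.const_mul three_pos) finFib_hexForm,
    thetaPart₁, hexCosetTheta, gf_mul finFib_pent_neg finFib_hexCoset,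
    thetaPart₂, gf_mul finFib_pent finFib_hexCoset]
  · congr 2
    · funext p
      zify
      refine mul_left_cancel₀ (two_ne_zero (α := ℤ)) ?_
      linear_combination two_mul_tri (p.1 + p.2.1) + two_mul_tri (p.1 + p.2.2)
        + two_mul_tri (p.1 - p.2.1 - p.2.2) - 3 * two_mul_tri p.1 - 2 * cast_hexForm p.2
    · funext p
      rw [mul_one, ← Units.val_mul, ← Units.val_mul, ← zpow_add, ← zpow_add]
      congr 2
      ring
    · congr 1
      · funext p
        zify
        refine mul_left_cancel₀ (two_ne_zero (α := ℤ)) ?_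
        linear_combination two_mul_tri (p.1 - p.2.1) + two_mul_tri (p.1 - p.2.2)
          + two_mul_tri (p.1 + 1 + p.2.1 + p.2.2) - two_mul_pent (-p.1 - 1)
          - 2 * cast_hexCoset p.2
      · funext p
        rw [mul_one, ← Units.val_mul, ← Units.val_mul, ← zpow_add, ← zpow_add]
        congr 2
        ring
    · congr 1
      · funext p
        zify
        refine mul_left_cancel₀ (two_ne_zero (α := ℤ)) ?_
        linear_combination two_mul_tri (p.1 + p.2.1) + two_mul_tri (p.1 + p.2.2)
          + two_mul_tri (p.1 - 1 - p.2.1 - p.2.2) - two_mul_pent p.1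
          - 2 * cast_hexCoset p.2
      · funext p
        rw [mul_one, ← Units.val_mul, ← Units.val_mul, ← zpow_add, ← zpow_add]
        congr 2
        ring
  · constructor
    · rintro (⟨u, m, n⟩ | ⟨u, m, n⟩ | ⟨u, m, n⟩) (⟨u', m', n'⟩ | ⟨u', m', n'⟩ | ⟨u', m', n'⟩) h <;>
      simp only [Sum.elim_inl, Sum.elim_inr, Prod.mk.injEq, Sum.inl.injEq, Sum.inr.injEq,
        reduceCtorEq] at h ⊢ <;> omega
    · rintro ⟨a, b, c⟩
      have h : (a + b + c) % 3 = 0 ∨ (a + b + c) % 3 = 1 ∨ (a + b + c) % 3 = 2 := by omega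
      rcases h with h | h | h
      · refine ⟨.inl ((a + b + c) / 3, a - (a + b + c) / 3, b - (a + b + c) / 3), ?_⟩
        simp only [Sum.elim_inl, Prod.mk.injEq]
        omega
      · refine ⟨.inr (.inl ((a + b + c) / 3, (a + b + c) / 3 - a, (a + b + c) / 3 - b)), ?_⟩
        simp only [Sum.elim_inl, Sum.elim_inr, Prod.mk.injEq]
        omega
      · refine ⟨.inr (.inr ((a + b + c + 1) / 3, a - (a + b + c + 1) / 3,
          b - (a + b + c + 1) / 3)), ?_⟩
        simp only [Sum.elim_inr, Prod.mk.injEq]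
        omega

/-- The index n is split mod 3: the triangular numbers of 3u, 3u + 1, 3u + 2 are 3 `pent u`, 9 `tri
u` + 1 and 3 `pent (-u - 1)`. -/
theorem theta_eq_dilate (z : Kˣ) :
    theta z = C (z : K) * dilate (thetaPart₂ z) + (C (z : K) * X * dilate (thetaPart₀ z)
      + C (z : K) * dilate (thetaPart₁ z)) := by
  rw [theta, gf_three_of_bijective finFib_tri (fun u : ℤ => 3 * u) (fun u : ℤ => 3 * u + 1)
    (fun u : ℤ => 3 * u + 2), thetaPart₀, thetaPart₁, thetaPart₂, ← gf_three_mul, ← gf_three_mul,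
    ← gf_three_mul, ← gf_const_mul (finFib_pent.const_mul three_pos),
    ← gf_const_mul (finFib_pent_neg.const_mul three_pos), mul_assoc, ← pow_one X,
    ← gf_add_const, ← gf_const_mul]
  · congr 2
    · funext u
      zify
      refine mul_left_cancel₀ (two_ne_zero (α := ℤ)) ?_
      linear_combination two_mul_tri (3 * u) - 3 * two_mul_pent u
    · funext u
      rw [← Units.val_mul, ← zpow_one_add]
      congr 2; ring
    · congr 1
      · funext u
        zify
        refine mul_left_cancel₀ (two_ne_zero (α := ℤ)) ?_
        linear_combination two_mul_tri (3 * u + 1) - 9 * two_mul_tri u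
      · funext u
        rw [← Units.val_mul, ← zpow_one_add]
        congr 2; ring
    · congr 1
      · funext u
        zify
        refine mul_left_cancel₀ (two_ne_zero (α := ℤ)) ?_
        linear_combination two_mul_tri (3 * u + 2) - 3 * two_mul_pent (-u - 1)
      · funext u
        rw [← Units.val_mul, ← zpow_one_add]
        congr 2; ring
  · exact ((finFib_tri.const_mul three_pos).const_mul three_pos).of_bound id
      Function.injective_id 0 fun _ => by simp
  · constructor
    · rintro (u | u | u) (u' | u' | u') h <;>
      simp only [Sum.elim_inl, Sum.elim_inr, Sum.inl.injEq, Sum.inr.injEq,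
        reduceCtorEq] at h ⊢ <;> omega
    · intro a
      have h : a % 3 = 0 ∨ a % 3 = 1 ∨ a % 3 = 2 := by omega
      rcases h with h | h | h
      · refine ⟨.inl (a / 3), ?_⟩
        simp only [Sum.elim_inl]
        omega
      · refine ⟨.inr (.inl (a / 3)), ?_⟩
        simp only [Sum.elim_inl, Sum.elim_inr]
        omega
      · refine ⟨.inr (.inr (a / 3)), ?_⟩
        simp only [Sum.elim_inr]
        omega

theorem dilate_thetaPart₀ (z : Kˣ) :
    thetaPart₀ z = dilate (theta (z ^ 3)) := by
  rw [thetaPart₀, theta, ← gf_three_mul]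
  congr 1
  funext u
  rw [zpow_mul, zpow_ofNat]

/-- The cube of Jacobi's theta series in terms of theta series. -/
theorem dilate_theta_pow_three (z : Kˣ) :
    C (z : K) * dilate (theta z) ^ 3 = C (z : K) * (dilate (hexTheta K)
      - X * dilate (hexCosetTheta K)) * dilate (dilate (theta (z ^ 3)))
      + dilate (hexCosetTheta K) * theta z := by
  rw [← dilate_thetaPart₀, ← map_pow, theta_pow_three, theta_eq_dilate z]
  simp only [map_add, map_mul]
  ring

end theta

/-! ### Index-three sublattices of the hexagonal lattice -/

section hexLattice

/-- The sublattice a ≡ b mod 3 is a rotated copy of the lattice with the norm form tripled. Its two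
other cosets are exchanged by swapping coordinates. -/
theorem bijective_hexSplit : (Sum.elim (fun p : ℤ × ℤ => (p.1 + 2 * p.2, p.1 - p.2))
    (Sum.elim (fun p : ℤ × ℤ => (p.1 + 2 * p.2 + 1, p.1 - p.2))
      fun p : ℤ × ℤ => (p.1 - p.2, p.1 + 2 * p.2 + 1))).Bijective := by
  constructor
  · rintro (⟨u, m⟩ | ⟨u, m⟩ | ⟨u, m⟩) (⟨u', m'⟩ | ⟨u', m'⟩ | ⟨u', m'⟩) h <;>
    simp only [Sum.elim_inl, Sum.elim_inr, Prod.mk.injEq, Sum.inl.injEq, Sum.inr.injEq,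
      reduceCtorEq] at h ⊢ <;> omega
  · rintro ⟨a, b⟩
    have h : (a - b) % 3 = 0 ∨ (a - b) % 3 = 1 ∨ (a - b) % 3 = 2 := by omega
    rcases h with h | h | h
    · refine ⟨.inl (b + (a - b) / 3, (a - b) / 3), ?_⟩
      simp only [Sum.elim_inl, Prod.mk.injEq]
      omega
    · refine ⟨.inr (.inl (b + (a - b) / 3, (a - b) / 3)), ?_⟩
      simp only [Sum.elim_inl, Sum.elim_inr, Prod.mk.injEq]
      omega
    · refine ⟨.inr (.inr (a + (b - a) / 3, (b - a) / 3)), ?_⟩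
      simp only [Sum.elim_inr, Prod.mk.injEq]
      omega

/-- These coordinates on the classes of a - b mod 3 are chosen so that `hexCoset` becomes the same
form on all three, reflecting the threefold symmetry about a deep hole; this is the source of the
factor 3 in c. -/
theorem bijective_hexSplit' : (Sum.elim (fun p : ℤ × ℤ => (p.1 + 2 * p.2, -2 * p.1 - p.2))
    (Sum.elim (fun p : ℤ × ℤ => (p.1 + 2 * p.2, p.1 - p.2 - 1))
      fun p : ℤ × ℤ => (p.1 - p.2 - 1, p.1 + 2 * p.2))).Bijective := by
  constructor
  · rintro (⟨u, m⟩ | ⟨u, m⟩ | ⟨u, m⟩) (⟨u', m'⟩ | ⟨u', m'⟩ | ⟨u', m'⟩) h <;>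
    simp only [Sum.elim_inl, Sum.elim_inr, Prod.mk.injEq, Sum.inl.injEq, Sum.inr.injEq,
      reduceCtorEq] at h ⊢ <;> omega
  · rintro ⟨a, b⟩
    have h : (a - b) % 3 = 0 ∨ (a - b) % 3 = 1 ∨ (a - b) % 3 = 2 := by omega
    rcases h with h | h | h
    · refine ⟨.inl (-b - (a - b) / 3, b + 2 * ((a - b) / 3)), ?_⟩
      simp only [Sum.elim_inl, Prod.mk.injEq]
      omega
    · refine ⟨.inr (.inl (b + 1 + (a - b - 1) / 3, (a - b - 1) / 3)), ?_⟩
      simp only [Sum.elim_inl, Sum.elim_inr, Prod.mk.injEq]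
      omega
    · refine ⟨.inr (.inr (a + 1 + (b - a - 1) / 3, (b - a - 1) / 3)), ?_⟩
      simp only [Sum.elim_inr, Prod.mk.injEq]
      omega

/-- The form `3 (m² + m n + n²) - m + n`, whose theta series counts 3-cores. -/
def coreForm (p : ℤ × ℤ) : ℕ := hexCoset (p.1 + 2 * p.2, -2 * p.1 - p.2)

theorem cast_coreForm (p : ℤ × ℤ) :
    (coreForm p : ℤ) = 3 * (p.1 ^ 2 + p.1 * p.2 + p.2 ^ 2) - p.1 + p.2 := by
  rw [coreForm, cast_hexCoset]
  ring

variable (K : Type*) [CommRing K]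

theorem hexTheta_eq_dilate :
    hexTheta K = dilate (hexTheta K) + 2 * X * dilate (hexCosetTheta K) := by
  conv_lhs => rw [hexTheta, gf_three_of_bijective finFib_hexForm _ _ _ bijective_hexSplit]
  have h : 2 * X * dilate (hexCosetTheta K)
      = X ^ 1 * dilate (hexCosetTheta K) + X ^ 1 * dilate (hexCosetTheta K) := by ring
  rw [h, hexTheta, hexCosetTheta, ← gf_three_mul, ← gf_three_mul, ← gf_add_const]
  congr 2
  · funext p
    zify
    linear_combination cast_hexForm (p.1 + 2 * p.2, p.1 - p.2) - 3 * cast_hexForm p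
  · congr 1
    funext p
    zify
    linear_combination cast_hexForm (p.1 + 2 * p.2 + 1, p.1 - p.2) - 3 * cast_hexCoset p
  · congr 1
    funext p
    zify
    linear_combination cast_hexForm (p.1 - p.2, p.1 + 2 * p.2 + 1) - 3 * cast_hexCoset p

theorem hexCosetTheta_eq_three_mul :
    hexCosetTheta K = 3 * gf coreForm fun _ => 1 := by
  rw [hexCosetTheta, gf_three_of_bijective finFib_hexCoset _ _ _ bijective_hexSplit']
  have h : (3 : K⟦X⟧) * gf coreForm (fun _ => 1) = gf coreForm (fun _ => 1)
      + (gf coreForm (fun _ => 1) + gf coreForm fun _ => 1) := by ring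
  rw [h]
  congr 2
  · congr 1
    funext p
    zify
    linear_combination cast_hexCoset (p.1 + 2 * p.2, p.1 - p.2 - 1) - cast_coreForm p
  · congr 1
    funext p
    zify
    linear_combination cast_hexCoset (p.1 - p.2 - 1, p.1 + 2 * p.2) - cast_coreForm p

end hexLattice

/-! ### Truncation modulo a power of the variable -/

section jet

variable {K L : Type*} [CommRing K] [CommRing L]

/-- The truncation of a power series modulo `X ^ N`. -/
noncomputable abbrev jet (N : ℕ) : K⟦X⟧ →+* K⟦X⟧ ⧸ Ideal.span {(X : K⟦X⟧) ^ N} :=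
  Ideal.Quotient.mk _

theorem jet_eq_jet_iff {N : ℕ} {f g : K⟦X⟧} :
    jet N f = jet N g ↔ ∀ n < N, coeff n f = coeff n g := by
  rw [Ideal.Quotient.eq, Ideal.mem_span_singleton, X_pow_dvd_iff]
  simp [sub_eq_zero]

theorem eq_of_jet_eq {f g : K⟦X⟧} (h : ∀ N, jet N f = jet N g) : f = g := by
  ext n
  exact jet_eq_jet_iff.1 (h (n + 1)) n n.lt_succ_self

theorem jet_X_pow_eq_zero {N m : ℕ} (h : N ≤ m) : jet N ((X : K⟦X⟧) ^ m) = 0 := by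
  rw [Ideal.Quotient.eq_zero_iff_mem, Ideal.mem_span_singleton]
  exact pow_dvd_pow _ h

theorem jet_map {N : ℕ} (r : K →+* L) {f g : K⟦X⟧} (h : jet N f = jet N g) :
    jet N (PowerSeries.map r f) = jet N (PowerSeries.map r g) := by
  rw [jet_eq_jet_iff] at h ⊢
  intro n hn
  rw [coeff_map, coeff_map, h n hn]

theorem jet_dilate {N : ℕ} {f g : K⟦X⟧} (h : jet N f = jet N g) :
    jet N (dilate f) = jet N (dilate g) := by
  rw [jet_eq_jet_iff] at h ⊢
  intro n hn
  rw [coeff_expand, coeff_expand]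
  split_ifs
  · exact h _ ((Nat.div_le_self _ _).trans_lt hn)
  · rfl

theorem dilate_injective : Function.Injective (dilate : K⟦X⟧ → K⟦X⟧) := by
  intro f g h
  ext n
  have := congrArg (coeff (3 * n)) h
  simpa [coeff_expand_mul] using this

theorem map_dilate (r : K →+* L) (f : K⟦X⟧) :
    PowerSeries.map r (dilate f) = dilate (PowerSeries.map r f) := by
  ext n
  simp only [coeff_map, coeff_expand]
  split_ifs <;> simp

end jet

/-! ### Euler's product -/

section euler

variable (K : Type*) [CommRing K]

/-- The finite product `∏_{1 ≤ i ≤ M} (1 - X ^ i)`. -/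
noncomputable def eulerFin (M : ℕ) : K⟦X⟧ := ∏ i ∈ Finset.range M, (1 - X ^ (i + 1))

/-- Euler's infinite product `∏_{i ≥ 1} (1 - X ^ i)`. -/
noncomputable def euler : K⟦X⟧ := PowerSeries.mk fun n => coeff n (eulerFin K n)

theorem eulerFin_succ (M : ℕ) : eulerFin K (M + 1) = eulerFin K M * (1 - X ^ (M + 1)) :=
  Finset.prod_range_succ _ _

theorem jet_eulerFin {N M : ℕ} (h : N ≤ M + 1) :
    jet N (eulerFin K M) = jet N (euler K) := by
  have key : ∀ n j, coeff n (eulerFin K (n + j)) = coeff n (eulerFin K n) := by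
    intro n j
    induction j with
    | zero => rfl
    | succ j ih =>
      rw [← ih, ← add_assoc, eulerFin_succ, mul_sub, mul_one, map_sub, coeff_mul_X_pow',
        if_neg (by omega), sub_zero]
  rw [jet_eq_jet_iff]
  intro n hn
  obtain ⟨j, rfl⟩ := Nat.exists_eq_add_of_le (show n ≤ M by omega)
  rw [key, euler, coeff_mk]

theorem constantCoeff_euler : constantCoeff (euler K) = 1 := by
  rw [← coeff_zero_eq_constantCoeff_apply, euler, coeff_mk, eulerFin]
  simp

theorem isUnit_euler : IsUnit (euler K) := by
  rw [PowerSeries.isUnit_iff_constantCoeff, constantCoeff_euler]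
  exact isUnit_one

theorem map_eulerFin {L : Type*} [CommRing L] (r : K →+* L) (M : ℕ) :
    PowerSeries.map r (eulerFin K M) = eulerFin L M := by
  simp [eulerFin, map_prod]

theorem map_euler {L : Type*} [CommRing L] (r : K →+* L) :
    PowerSeries.map r (euler K) = euler L := by
  refine eq_of_jet_eq fun N => ?_
  rw [← jet_map r (jet_eulerFin K N.le_succ), map_eulerFin, jet_eulerFin L N.le_succ]

end euler

/-! ### Gaussian binomials and the finite q-binomial theorem -/

section qBinomial

variable (K : Type*) [CommRing K]

/-- The Gaussian binomial coefficients, as power series in `q = X`. -/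
noncomputable def qBinom : ℕ → ℕ → K⟦X⟧
  | _, 0 => 1
  | 0, _ + 1 => 0
  | n + 1, k + 1 => qBinom n k + X ^ (k + 1) * qBinom n (k + 1)

theorem qBinom_zero_right (n : ℕ) : qBinom K n 0 = 1 := by cases n <;> rfl

theorem qBinom_succ_succ (n k : ℕ) :
    qBinom K (n + 1) (k + 1) = qBinom K n k + X ^ (k + 1) * qBinom K n (k + 1) := rfl

theorem qBinom_eq_zero {n k : ℕ} (h : n < k) : qBinom K n k = 0 := by
  induction n generalizing k with
  | zero => obtain ⟨k, rfl⟩ := Nat.exists_eq_succ_of_ne_zero h.ne'; rfl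
  | succ n ih =>
    obtain ⟨k, rfl⟩ := Nat.exists_eq_succ_of_ne_zero (Nat.ne_zero_of_lt h)
    rw [Nat.succ_eq_add_one, qBinom_succ_succ, ih (by omega), ih (by omega), mul_zero, add_zero]

theorem qBinom_mul_eulerFin (j k : ℕ) :
    qBinom K (j + k) k * (eulerFin K k * eulerFin K j) = eulerFin K (j + k) := by
  induction k generalizing j with
  | zero => simp [qBinom_zero_right, eulerFin]
  | succ k ihk =>
    induction j with
    | zero =>
      have h := ihk 0
      rw [zero_add] at h ⊢
      rw [qBinom_succ_succ, qBinom_eq_zero K k.lt_succ_self, eulerFin_succ]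
      linear_combination (1 - X ^ (k + 1)) * h
    | succ j ihj =>
      have h := ihk (j + 1)
      rw [← add_assoc, qBinom_succ_succ, eulerFin_succ K (j + 1 + k), eulerFin_succ K j,
        eulerFin_succ K k]
      rw [eulerFin_succ K j] at h
      have h2 : j + (k + 1) = j + 1 + k := by omega
      rw [h2, eulerFin_succ K k] at ihj
      linear_combination (1 - X ^ (k + 1)) * h + X ^ (k + 1) * (1 - X ^ (j + 1)) * ihj

/-- The q-binomial theorem is made homogeneous in x and y so that y may later be a power of `X`; the
finite triple product then needs no negative powers of `X`. -/
theorem prod_add_mul_X_pow (N : ℕ) (x y : K⟦X⟧) :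
    ∏ n ∈ Finset.range N, (y + x * X ^ n)
      = ∑ k ∈ Finset.range (N + 1), X ^ (k.choose 2) * qBinom K N k * x ^ k * y ^ (N - k) := by
  induction N generalizing x with
  | zero => simp [qBinom_zero_right]
  | succ N ih =>
    have h : ∀ n ∈ Finset.range N, y + x * X ^ (n + 1) = y + (x * X) * X ^ n := fun n _ => by ring
    rw [Finset.prod_range_succ', Finset.prod_congr rfl h, ih, pow_zero, mul_one, mul_add]
    have hy : (∑ k ∈ Finset.range (N + 1),
        X ^ (k.choose 2) * qBinom K N k * (x * X) ^ k * y ^ (N - k)) * y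
        = ∑ k ∈ Finset.range (N + 2),
          X ^ (k.choose 2) * qBinom K N k * (x * X) ^ k * y ^ (N + 1 - k) := by
      rw [Finset.sum_range_succ _ (N + 1), qBinom_eq_zero K N.lt_succ_self, Finset.sum_mul]
      simp only [mul_zero, zero_mul, add_zero]
      refine Finset.sum_congr rfl fun k hk => ?_
      rw [Finset.mem_range] at hk
      rw [Nat.succ_sub (by omega), pow_succ]
      ring
    rw [hy, Finset.sum_range_succ', Finset.sum_range_succ' _ (N + 1), Finset.sum_mul,
      add_right_comm, ← Finset.sum_add_distrib]
    congr 1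
    · refine Finset.sum_congr rfl fun k hk => ?_
      rw [Nat.succ_sub_succ, qBinom_succ_succ, Nat.choose_succ_succ' k 1, Nat.choose_one_right]
      ring
    · simp [qBinom_zero_right]

end qBinomial

/-! ### Jacobi's triple product and its special values -/

section tripleProduct

variable {K : Type*} [CommRing K]

/-- The truncated Jacobi product `∏_{n < M} (1 + z X^(n+1)) (1 + z⁻¹ X^n)`. -/
noncomputable def jacobiProd (z : Kˣ) (M : ℕ) : K⟦X⟧ :=
  ∏ n ∈ Finset.range M, ((1 + C (z : K) * X ^ (n + 1)) * (1 + C ((z⁻¹ : Kˣ) : K) * X ^ n))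

theorem two_mul_choose_two (k : ℕ) : 2 * (k.choose 2 : ℤ) = k * (k - 1) := by
  induction k with
  | zero => simp
  | succ k ih =>
    rw [Nat.choose_succ_succ' k 1, Nat.choose_one_right]
    push_cast
    linear_combination ih

theorem prod_X_pow_succ (M : ℕ) :
    ∏ n ∈ Finset.range M, (X : K⟦X⟧) ^ (n + 1) = X ^ ((M + 1).choose 2) := by
  induction M with
  | zero => simp
  | succ M ih =>
    rw [Finset.prod_range_succ, ih, Nat.choose_succ_succ' (M + 1) 1, Nat.choose_one_right]
    ring

/-- The first M factors, reversed and with zXⁿ⁺¹ taken out, give the product in z⁻¹; the last M,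
with Xᴹ taken out, give the product in z. -/
theorem prod_X_pow_add (z : Kˣ) (M : ℕ) :
    ∏ n ∈ Finset.range (M + M), (X ^ M + C (z : K) * X * X ^ n)
      = X ^ (M * M + (M + 1).choose 2) * (C ((z ^ M : Kˣ) : K) * jacobiProd z M) := by
  have hz : C (z : K) * C ((z⁻¹ : Kˣ) : K) = 1 := by rw [← map_mul, Units.mul_inv, map_one]
  have h1 : ∏ n ∈ Finset.range M, (X ^ M + C (z : K) * X * X ^ n)
      = C ((z ^ M : Kˣ) : K) * X ^ ((M + 1).choose 2)
        * ∏ n ∈ Finset.range M, (1 + C ((z⁻¹ : Kˣ) : K) * X ^ n) := by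
    rw [← Finset.prod_range_reflect (fun n => (1 + C ((z⁻¹ : Kˣ) : K) * X ^ n)),
      ← prod_X_pow_succ, Units.val_pow_eq_pow_val, map_pow]
    conv_rhs => rw [← Finset.card_range M, ← Finset.prod_const, Finset.card_range]
    rw [← Finset.prod_mul_distrib, ← Finset.prod_mul_distrib]
    refine Finset.prod_congr rfl fun n hn => ?_
    rw [Finset.mem_range] at hn
    obtain ⟨m, rfl⟩ := Nat.exists_eq_add_of_lt hn
    have : n + m + 1 - 1 - n = m := by omega
    rw [this]
    linear_combination (-(X : K⟦X⟧) ^ (n + m + 1)) * hz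
  have h2 : ∏ n ∈ Finset.range M, (X ^ M + C (z : K) * X * X ^ (M + n))
      = X ^ (M * M) * ∏ n ∈ Finset.range M, (1 + C (z : K) * X ^ (n + 1)) := by
    rw [pow_mul]
    conv_rhs => rw [← Finset.card_range M, ← Finset.prod_const, Finset.card_range]
    rw [← Finset.prod_mul_distrib]
    exact Finset.prod_congr rfl fun n _ => by ring
  rw [Finset.prod_range_add, h1, h2, jacobiProd, Finset.prod_mul_distrib]
  ring

theorem jacobiProd_eq_sum (z : Kˣ) (M : ℕ) :
    jacobiProd z M = ∑ k ∈ Finset.range (M + M + 1),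
      qBinom K (M + M) k * (C ((z ^ (k - M : ℤ) : Kˣ) : K) * X ^ tri (k - M)) := by
  have h := prod_add_mul_X_pow K (M + M) (C (z : K) * X) (X ^ M)
  rw [prod_X_pow_add] at h
  have hz : C ((z ^ M : Kˣ) : K) * C (((z ^ M)⁻¹ : Kˣ) : K) = 1 := by
    rw [← map_mul, Units.mul_inv, map_one]
  have hu : IsUnit (C ((z ^ M : Kˣ) : K)) := .of_mul_eq_one _ hz
  refine hu.mul_left_cancel (X_pow_mul_cancel (h.trans ?_))
  rw [Finset.mul_sum, Finset.mul_sum]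
  refine Finset.sum_congr rfl fun k hk => ?_
  rw [Finset.mem_range] at hk
  have hpow : (X : K⟦X⟧) ^ (k.choose 2) * X ^ k * (X ^ M) ^ (M + M - k)
      = X ^ (M * M + (M + 1).choose 2) * X ^ tri (k - M) := by
    rw [← pow_mul, ← pow_add, ← pow_add, ← pow_add]
    congr 1
    zify [show k ≤ M + M by omega]
    refine mul_left_cancel₀ (two_ne_zero (α := ℤ)) ?_
    have h1 := two_mul_choose_two (M + 1)
    push_cast at h1
    linear_combination two_mul_choose_two k - h1 - two_mul_tri (k - M)
  have hC : C (z : K) ^ k = C ((z ^ M : Kˣ) : K) * C ((z ^ (k - M : ℤ) : Kˣ) : K) := by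
    rw [← map_mul, ← Units.val_mul, ← zpow_natCast z M, ← zpow_add, ← map_pow,
      ← Units.val_pow_eq_pow_val, ← zpow_natCast]
    congr 3
    ring
  rw [mul_pow, hC]
  linear_combination (qBinom K (M + M) k * C ((z ^ M : Kˣ) : K)
    * C ((z ^ (k - M : ℤ) : Kˣ) : K)) * hpow

/-- In `qBinom_mul_eulerFin` all three finite products agree with `euler` to this precision, and one
copy of this unit cancels. -/
theorem jet_euler_mul_qBinom {N j k : ℕ} (hj : N ≤ j + 1) (hk : N ≤ k + 1) :
    jet N (euler K * qBinom K (j + k) k) = 1 := by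
  have h := congrArg (jet N) (qBinom_mul_eulerFin K j k)
  rw [map_mul, map_mul, jet_eulerFin K hj, jet_eulerFin K hk,
    jet_eulerFin K (by omega : N ≤ j + k + 1)] at h
  refine ((isUnit_euler K).map (jet N)).mul_left_cancel ?_
  rw [map_mul]
  linear_combination h

theorem jet_theta_eq_sum (z : Kˣ) {N M : ℕ} (hM : 2 * N ≤ M) :
    jet N (theta z) = jet N (∑ k ∈ Finset.range (M + M + 1),
      C ((z ^ (k - M : ℤ) : Kˣ) : K) * X ^ tri (k - M)) := by
  classical
  rw [jet_eq_jet_iff]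
  intro n hn
  rw [map_sum, theta, coeff_gf_of_finFib finFib_tri]
  simp_rw [coeff_C_mul_X_pow]
  rw [← Finset.sum_filter]
  refine Finset.sum_bij' (fun d _ => (d + M).toNat) (fun k _ => (k : ℤ) - M) ?_ ?_ ?_ ?_ ?_
  · intro d hd
    simp only [Set.Finite.mem_toFinset, Set.mem_ofPred_eq] at hd
    have := le_two_mul_tri d
    rw [hd, abs_le] at this
    simp only [Finset.mem_filter, Finset.mem_range]
    refine ⟨by omega, ?_⟩
    rw [← hd]
    congr 1
    omega
  · intro k hk
    simp only [Finset.mem_filter] at hk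
    simp only [Set.Finite.mem_toFinset, Set.mem_ofPred_eq]
    exact hk.2.symm
  · intro d hd
    simp only [Set.Finite.mem_toFinset, Set.mem_ofPred_eq] at hd
    have := le_two_mul_tri d
    rw [hd, abs_le] at this
    omega
  · intro k hk
    omega
  · intro d hd
    simp only [Set.Finite.mem_toFinset, Set.mem_ofPred_eq] at hd
    have := le_two_mul_tri d
    rw [hd, abs_le] at this
    congr 2
    omega

/-- **Jacobi's triple product identity**, to any finite precision. -/
theorem jet_theta_eq_jacobiProd (z : Kˣ) {N M : ℕ} (hM : 3 * N ≤ M) :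
    jet N (theta z) = jet N (euler K * jacobiProd z M) := by
  rw [jet_theta_eq_sum z (M := M) (by omega), jacobiProd_eq_sum, Finset.mul_sum, map_sum, map_sum]
  refine Finset.sum_congr rfl fun k hk => ?_
  rw [Finset.mem_range] at hk
  rw [← mul_assoc, map_mul _ (euler K * _)]
  -- Either the triangular exponent already exceeds the precision, or |k - M| < 2N and then both k
  -- and 2M - k are at least N, because M ≥ 3N.
  rcases le_or_gt N (tri (k - M)) with h | h
  · rw [map_mul, jet_X_pow_eq_zero h, mul_zero, mul_zero]
  · have h2 := le_two_mul_tri (k - M)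
    rw [abs_le] at h2
    have h3 : M + M = (M + M - k) + k := by omega
    rw [h3, jet_euler_mul_qBinom (by omega) (by omega), one_mul]

/-- Shifting the product in z⁻¹ by one isolates the factor 1 + z⁻¹, which vanishes at z = -1. -/
theorem jacobiProd_mul (z : Kˣ) (M : ℕ) :
    jacobiProd z M * (1 + C ((z⁻¹ : Kˣ) : K) * X ^ M) = (1 + C ((z⁻¹ : Kˣ) : K))
      * ∏ n ∈ Finset.range M,
        ((1 + C (z : K) * X ^ (n + 1)) * (1 + C ((z⁻¹ : Kˣ) : K) * X ^ (n + 1))) := by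
  rw [jacobiProd, Finset.prod_mul_distrib, Finset.prod_mul_distrib, mul_assoc,
    ← Finset.prod_range_succ (fun n => 1 + C ((z⁻¹ : Kˣ) : K) * X ^ n),
    Finset.prod_range_succ']
  ring

theorem jet_theta (z : Kˣ) {N M : ℕ} (hM : 3 * N ≤ M) :
    jet N (theta z) = jet N (euler K * ((1 + C ((z⁻¹ : Kˣ) : K)) * ∏ n ∈ Finset.range M,
      ((1 + C (z : K) * X ^ (n + 1)) * (1 + C ((z⁻¹ : Kˣ) : K) * X ^ (n + 1))))) := by
  rw [← jacobiProd_mul, ← mul_assoc, map_mul _ (euler K * _), ← jet_theta_eq_jacobiProd z hM,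
    map_add, map_one, map_mul, jet_X_pow_eq_zero (by omega), mul_zero, add_zero, mul_one]

theorem theta_eq_zero (z : Kˣ) (hz : 1 + ((z⁻¹ : Kˣ) : K) = 0) : theta z = 0 := by
  refine eq_of_jet_eq fun N => ?_
  rw [jet_theta z le_rfl, ← map_one C, ← map_add, hz, map_zero, zero_mul, mul_zero]

/-- The triple product at a primitive sixth root of unity. -/
theorem theta_of_add_inv_eq_one (z : Kˣ) (hz : (z : K) + ((z⁻¹ : Kˣ) : K) = 1) :
    theta z = C (1 + ((z⁻¹ : Kˣ) : K)) * dilate (euler K) := by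
  refine eq_of_jet_eq fun N => ?_
  rw [jet_theta z le_rfl, map_mul _ (C _), jet_dilate (jet_eulerFin K (by omega : N ≤ 3 * N + 1)).symm,
    map_mul, ← jet_eulerFin K (by omega : N ≤ 3 * N + 1), ← map_mul, ← map_mul, map_add, map_one]
  congr 1
  rw [mul_left_comm, eulerFin, ← Finset.prod_mul_distrib, map_prod]
  congr 1
  refine Finset.prod_congr rfl fun n _ => ?_
  have h1 : C (z : K) * C ((z⁻¹ : Kˣ) : K) = 1 := by rw [← map_mul, Units.mul_inv, map_one]
  have h2 : C (z : K) + C ((z⁻¹ : Kˣ) : K) = 1 := by rw [← map_add, hz, map_one]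
  rw [map_sub, map_one, map_pow, expand_X]
  linear_combination (1 - (X : K⟦X⟧) ^ (n + 1)) * X ^ (n + 1) * h2
    + (1 - (X : K⟦X⟧) ^ (n + 1)) * (X ^ (n + 1)) ^ 2 * h1

/-- Since a annihilates u + 1, u may be replaced by -1 in anything multiplied by a. -/
theorem C_mul_prod_eq {a u : K} (h : a * u = -a) (M : ℕ) :
    C a * ∏ n ∈ Finset.range M, (1 + C u * X ^ (n + 1)) = C a * eulerFin K M := by
  have h' : C a * C u = -C a := by rw [← map_mul, h, map_neg]
  induction M with
  | zero => simp [eulerFin]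
  | succ M ih =>
    rw [Finset.prod_range_succ, eulerFin_succ]
    linear_combination (1 + C u * X ^ (M + 1)) * ih + eulerFin K M * X ^ (M + 1) * h'

/-- The triple product to first order at `-1`. -/
theorem theta_infinitesimal (z : Kˣ) {a : K} (hz : 1 + ((z⁻¹ : Kˣ) : K) = a)
    (h1 : a * z = -a) (h2 : a * ((z⁻¹ : Kˣ) : K) = -a) :
    theta z = C a * euler K ^ 3 := by
  refine eq_of_jet_eq fun N => ?_
  rw [jet_theta z le_rfl, ← map_one C, ← map_add, hz, map_one, Finset.prod_mul_distrib,
    ← mul_assoc (C a), C_mul_prod_eq h1, mul_right_comm, C_mul_prod_eq h2, map_mul, map_mul,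
    map_mul, jet_eulerFin K (by omega : N ≤ 3 * N + 1), map_mul, map_pow]
  ring

end tripleProduct

/-! ### Specialising the cubic theta identity: a sixth root of unity and a dual number -/

/-- A primitive sixth root of unity. -/
noncomputable def sixthRoot : ℂˣ where
  val := (1 + Real.sqrt 3 * Complex.I) / 2
  inv := (1 - Real.sqrt 3 * Complex.I) / 2
  val_inv := by
    have h : (Real.sqrt 3 : ℂ) ^ 2 = 3 := by
      rw [← Complex.ofReal_pow, Real.sq_sqrt (by norm_num)]; norm_num
    linear_combination h / 4 - (Real.sqrt 3 : ℂ) ^ 2 * Complex.I_sq / 4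
  inv_val := by
    have h : (Real.sqrt 3 : ℂ) ^ 2 = 3 := by
      rw [← Complex.ofReal_pow, Real.sq_sqrt (by norm_num)]; norm_num
    linear_combination h / 4 - (Real.sqrt 3 : ℂ) ^ 2 * Complex.I_sq / 4

theorem sixthRoot_add_inv : (sixthRoot : ℂ) + ((sixthRoot⁻¹ : ℂˣ) : ℂ) = 1 := by
  change (1 + Real.sqrt 3 * Complex.I) / 2 + (1 - Real.sqrt 3 * Complex.I) / 2 = (1 : ℂ)
  ring

theorem sixthRoot_pow_three : sixthRoot ^ 3 = -1 := by
  have h1 := sixthRoot_add_inv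
  have h2 : (sixthRoot : ℂ) * ((sixthRoot⁻¹ : ℂˣ) : ℂ) = 1 := Units.mul_inv _
  ext
  rw [Units.val_pow_eq_pow_val, Units.val_neg, Units.val_one]
  linear_combination ((sixthRoot : ℂ) ^ 2 + sixthRoot) * h1 - (sixthRoot + 1) * h2

/-- The theta series of the hexagonal lattice at a deep hole is an eta quotient. -/
theorem hexCosetTheta_mul_euler : hexCosetTheta ℤ * euler ℤ = 3 * dilate (euler ℤ) ^ 3 := by
  have h1 := sixthRoot_add_inv
  have h2 : (sixthRoot : ℂ) * ((sixthRoot⁻¹ : ℂˣ) : ℂ) = 1 := Units.mul_inv _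
  set u : ℂ := 1 + ((sixthRoot⁻¹ : ℂˣ) : ℂ) with hu
  have hu3 : (sixthRoot : ℂ) * u ^ 2 = 3 := by
    linear_combination (sixthRoot * (u + 1 + ((sixthRoot⁻¹ : ℂˣ) : ℂ))) * hu + h1
      + (2 + ((sixthRoot⁻¹ : ℂˣ) : ℂ)) * h2
  have hu0 : u ≠ 0 := by
    rintro h
    rw [h] at hu3
    norm_num at hu3
  have h := dilate_theta_pow_three sixthRoot
  -- As z³ = -1, the term containing θ(z³) drops out, leaving c as a quotient of the product
  -- formulas for θ(z).
  rw [sixthRoot_pow_three, theta_eq_zero (-1) (by simp), theta_of_add_inv_eq_one _ h1, ← hu] at h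
  simp only [map_zero, mul_zero, zero_add, map_mul, expand_C] at h
  have hC : C (sixthRoot : ℂ) * C u ^ 2 = 3 := by
    rw [← map_pow, ← map_mul, hu3]; rfl
  have hCu : C u ≠ 0 := by simpa using hu0
  have key : hexCosetTheta ℂ * euler ℂ = 3 * dilate (euler ℂ) ^ 3 := by
    apply dilate_injective
    apply mul_left_cancel₀ hCu
    simp only [map_mul, map_pow, map_ofNat]
    linear_combination (-1 : ℂ⟦X⟧) * h + C u * dilate (dilate (euler ℂ)) ^ 3 * hC
  apply PowerSeries.map_injective (Int.castRingHom ℂ) Int.cast_injective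
  rw [map_mul, map_hexCosetTheta, map_euler, map_mul, map_pow, map_dilate, map_euler, map_ofNat,
    key]

/-- The unit `-(1 + ε)` of the dual numbers. -/
def negOneSubEps : (DualNumber ℤ)ˣ where
  val := -(1 + DualNumber.eps)
  inv := -(1 - DualNumber.eps)
  val_inv := by linear_combination (-1 : DualNumber ℤ) * DualNumber.eps_mul_eps (R := ℤ)
  inv_val := by linear_combination (-1 : DualNumber ℤ) * DualNumber.eps_mul_eps (R := ℤ)

theorem val_negOneSubEps : (negOneSubEps : DualNumber ℤ) = -(1 + DualNumber.eps) := rfl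

theorem val_inv_negOneSubEps :
    ((negOneSubEps⁻¹ : (DualNumber ℤ)ˣ) : DualNumber ℤ) = -(1 - DualNumber.eps) := rfl

theorem eq_zero_of_C_eps_mul {F : ℤ⟦X⟧}
    (h : C DualNumber.eps * PowerSeries.map (Int.castRingHom (DualNumber ℤ)) F = 0) : F = 0 := by
  ext n
  have h1 := congrArg (fun G => TrivSqZeroExt.snd (coeff n G)) h
  simpa using h1

/-- The 3-dissection of the cube of Euler's product. -/
theorem euler_pow_three : euler ℤ ^ 3
    = (dilate (hexTheta ℤ) - X * dilate (hexCosetTheta ℤ)) * dilate (euler ℤ) := by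
  have he := DualNumber.eps_mul_eps (R := ℤ)
  have h := dilate_theta_pow_three negOneSubEps
  -- At z = -(1 + ε) both θ(z) and θ(z³) are of first order, with 1 + z⁻¹ = ε and 1 + z⁻³ = 3ε.
  rw [theta_infinitesimal negOneSubEps (a := DualNumber.eps)
      (by rw [val_inv_negOneSubEps]; ring)
      (by rw [val_negOneSubEps]; linear_combination (-1 : DualNumber ℤ) * he)
      (by rw [val_inv_negOneSubEps]; linear_combination he),
    theta_infinitesimal (negOneSubEps ^ 3) (a := 3 * DualNumber.eps)
      (by rw [← inv_pow, Units.val_pow_eq_pow_val, val_inv_negOneSubEps]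
          linear_combination (-3 + DualNumber.eps : DualNumber ℤ) * he)
      (by rw [Units.val_pow_eq_pow_val, val_negOneSubEps]
          linear_combination
            (-9 - 9 * DualNumber.eps - 3 * DualNumber.eps ^ 2 : DualNumber ℤ) * he)
      (by rw [← inv_pow, Units.val_pow_eq_pow_val, val_inv_negOneSubEps]
          linear_combination
            (9 - 9 * DualNumber.eps + 3 * DualNumber.eps ^ 2 : DualNumber ℤ) * he),
    val_negOneSubEps] at h
  simp only [map_mul, map_pow, expand_C, map_neg, map_add, map_one, map_ofNat] at h
  have hC : C (DualNumber.eps (R := ℤ)) * C DualNumber.eps = 0 := by rw [← map_mul, he, map_zero]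
  set e := C (DualNumber.eps (R := ℤ)) with hedef
  set A := hexTheta (DualNumber ℤ)
  set k := hexCosetTheta (DualNumber ℤ)
  set E := euler (DualNumber ℤ)
  -- The cube of θ(z) carries ε³ = 0, so the two remaining terms balance; what is left is the
  -- derivative of the identity at z = -1.
  have h2 : e * (dilate k * E ^ 3 - 3 * (dilate A - X * dilate k) * dilate (dilate E) ^ 3) = 0 := by
    linear_combination (-1 : (DualNumber ℤ)⟦X⟧) * h
      + (3 * (dilate A - X * dilate k) * dilate (dilate E) ^ 3
        - (1 + e) * e * dilate E ^ 9) * hC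
  have h3 : dilate (hexCosetTheta ℤ) * euler ℤ ^ 3 - 3 * (dilate (hexTheta ℤ)
      - X * dilate (hexCosetTheta ℤ)) * dilate (dilate (euler ℤ)) ^ 3 = 0 := by
    apply eq_zero_of_C_eps_mul
    simp only [map_mul, map_sub, map_pow, map_dilate, map_hexTheta, map_hexCosetTheta, map_euler,
      map_ofNat, map_X]
    exact h2
  have hk := congrArg dilate hexCosetTheta_mul_euler
  simp only [map_mul, map_pow, map_ofNat] at hk
  have hk0 : dilate (hexCosetTheta ℤ) ≠ 0 := by
    rw [Ne, map_eq_zero_iff _ dilate_injective]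
    intro h0
    have := congrArg constantCoeff hexCosetTheta_mul_euler
    rw [h0, zero_mul] at this
    rw [map_zero, map_mul, map_pow, constantCoeff_expand, constantCoeff_euler, map_ofNat] at this
    norm_num at this
  apply mul_left_cancel₀ hk0
  linear_combination h3 - (dilate (hexTheta ℤ) - X * dilate (hexCosetTheta ℤ)) * hk

/-! ### Constant terms, and the constant term of the ninth power of theta -/

section constantTerm

open LaurentPolynomial (T)

/-- The constant term with respect to `T`, as an additive map. -/
noncomputable def laurentConst : LaurentPolynomial ℤ →+ ℤ where
  toFun p := p.coeff 0
  map_zero' := rfl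
  map_add' p q := by rw [AddMonoidAlgebra.coeff_add]; rfl

theorem laurentConst_T (n : ℤ) : laurentConst (T n) = if n = 0 then 1 else 0 :=
  LaurentPolynomial.T_apply 0 n

theorem laurentConst_intCast_mul (a : ℤ) (p : LaurentPolynomial ℤ) :
    laurentConst (a * p) = a * laurentConst p := by
  rw [← zsmul_eq_mul, map_zsmul, smul_eq_mul]

/-- The constant term with respect to `T` of a power series over `ℤ[T;T⁻¹]`. -/
noncomputable def constTerm : (LaurentPolynomial ℤ)⟦X⟧ →+ ℤ⟦X⟧ where
  toFun F := PowerSeries.mk fun n => laurentConst (coeff n F)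
  map_zero' := by ext; simp
  map_add' F G := by ext; simp

theorem coeff_constTerm (F : (LaurentPolynomial ℤ)⟦X⟧) (n : ℕ) :
    coeff n (constTerm F) = laurentConst (coeff n F) :=
  coeff_mk n fun n => laurentConst (coeff n F)

/-- The embedding of integral power series. -/
noncomputable abbrev toLaurentSeries : ℤ⟦X⟧ →+* (LaurentPolynomial ℤ)⟦X⟧ :=
  PowerSeries.map (Int.castRingHom _)

theorem constTerm_map_mul (F : ℤ⟦X⟧) (G : (LaurentPolynomial ℤ)⟦X⟧) :
    constTerm (toLaurentSeries F * G) = F * constTerm G := by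
  ext n
  rw [coeff_constTerm, coeff_mul, coeff_mul, map_sum]
  refine Finset.sum_congr rfl fun p _ => ?_
  rw [coeff_map, eq_intCast, laurentConst_intCast_mul, coeff_constTerm]

theorem jet_constTerm {N : ℕ} {F G : (LaurentPolynomial ℤ)⟦X⟧} (h : jet N F = jet N G) :
    jet N (constTerm F) = jet N (constTerm G) := by
  rw [jet_eq_jet_iff] at h ⊢
  intro n hn
  rw [coeff_constTerm, coeff_constTerm, h n hn]

variable {ι κ : Type*}

theorem constTerm_gf_eq_zero {f : ι → ℕ} (hf : FinFib f) {c : ι → ℤ} (hc : ∀ i, c i ≠ 0) :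
    constTerm (gf f fun i => T (c i)) = 0 := by
  ext N
  rw [coeff_constTerm, coeff_gf_of_finFib hf, map_sum, map_zero]
  exact Finset.sum_eq_zero fun i _ => by rw [laurentConst_T, if_neg (hc i)]

theorem constTerm_gf {f : ι → ℕ} (hf : FinFib f) {c : ι → ℤ} {j : κ → ι}
    (hj : j.Injective) (hc : ∀ i, c i = 0 ↔ i ∈ Set.range j) :
    constTerm (gf f fun i => T (c i)) = gf (fun k => f (j k)) fun _ => 1 := by
  classical
  have hg : FinFib fun k => f (j k) := hf.comp hj
  ext N
  rw [coeff_constTerm, coeff_gf_of_finFib hf, coeff_gf_of_finFib hg, map_sum]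
  simp_rw [laurentConst_T]
  rw [← Finset.sum_filter]
  refine (Finset.sum_bij (fun k _ => j k) ?_ (fun _ _ _ _ h => hj h) ?_ fun _ _ => rfl).symm
  · intro k hk
    simp only [Set.Finite.mem_toFinset, Set.mem_ofPred_eq, Finset.mem_filter] at hk ⊢
    exact ⟨hk, (hc _).2 ⟨k, rfl⟩⟩
  · intro i hi
    simp only [Set.Finite.mem_toFinset, Set.mem_ofPred_eq, Finset.mem_filter] at hi
    obtain ⟨k, rfl⟩ := (hc i).1 hi.2
    exact ⟨k, by simpa using hi.1, rfl⟩

theorem gf_mul_three {f₁ f₂ f₃ : ℤ → ℕ} (h₁ : FinFib f₁) (h₂ : FinFib f₂) (h₃ : FinFib f₃)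
    (r₁ r₂ r₃ : ℤ) :
    gf f₁ (fun u => (T (3 * u + r₁) : LaurentPolynomial ℤ)) * (gf f₂ (fun u => T (3 * u + r₂))
      * gf f₃ fun u => T (3 * u + r₃))
    = gf (fun p : ℤ × ℤ × ℤ => f₁ p.1 + (f₂ p.2.1 + f₃ p.2.2))
        fun p => T (3 * (p.1 + p.2.1 + p.2.2) + (r₁ + r₂ + r₃)) := by
  rw [gf_mul h₂ h₃, gf_mul h₁ (h₂.prod h₃)]
  congr 1
  funext p
  rw [← LaurentPolynomial.T_add, ← LaurentPolynomial.T_add]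
  congr 1
  ring

theorem constTerm_mul_three_eq_zero {f₁ f₂ f₃ : ℤ → ℕ} (h₁ : FinFib f₁) (h₂ : FinFib f₂)
    (h₃ : FinFib f₃) {r₁ r₂ r₃ : ℤ} (h : ¬ 3 ∣ r₁ + r₂ + r₃) :
    constTerm (gf f₁ (fun u => T (3 * u + r₁)) * (gf f₂ (fun u => T (3 * u + r₂))
      * gf f₃ fun u => T (3 * u + r₃))) = 0 := by
  rw [gf_mul_three h₁ h₂ h₃]
  exact constTerm_gf_eq_zero (h₁.prod (h₂.prod h₃)) fun p => by omega

theorem constTerm_mul_three {f₁ f₂ f₃ : ℤ → ℕ} (h₁ : FinFib f₁) (h₂ : FinFib f₂)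
    (h₃ : FinFib f₃) {r₁ r₂ r₃ : ℤ} (s : ℤ) (h : r₁ + r₂ + r₃ = 3 * s) :
    constTerm (gf f₁ (fun u => T (3 * u + r₁)) * (gf f₂ (fun u => T (3 * u + r₂))
      * gf f₃ fun u => T (3 * u + r₃)))
    = gf (fun p : ℤ × ℤ => f₁ p.1 + (f₂ p.2 + f₃ (-s - p.1 - p.2))) fun _ => 1 := by
  rw [gf_mul_three h₁ h₂ h₃]
  refine constTerm_gf (h₁.prod (h₂.prod h₃)) (j := fun p : ℤ × ℤ => (p.1, p.2, -s - p.1 - p.2))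
    ?_ ?_
  · rintro ⟨a, b⟩ ⟨a', b'⟩ h
    simp only [Prod.mk.injEq] at h ⊢
    exact ⟨h.1, h.2.1⟩
  · rintro ⟨a, b, c⟩
    simp only [Set.mem_range, Prod.mk.injEq, Prod.exists]
    refine ⟨fun h => ⟨a, b, rfl, rfl, by omega⟩, ?_⟩
    rintro ⟨a', b', rfl, rfl, h⟩
    omega

/-- The variable `T` as a unit. -/
noncomputable def laurentUnit : (LaurentPolynomial ℤ)ˣ where
  val := T 1
  inv := T (-1)
  val_inv := by rw [← LaurentPolynomial.T_add]; rfl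
  inv_val := by rw [← LaurentPolynomial.T_add]; rfl

theorem laurentUnit_zpow (n : ℤ) : ((laurentUnit ^ n : (LaurentPolynomial ℤ)ˣ) :
    LaurentPolynomial ℤ) = T n := by
  have h : ∀ n : ℕ, ((laurentUnit ^ n : (LaurentPolynomial ℤ)ˣ) : LaurentPolynomial ℤ)
      = T (n : ℤ) := fun n => by
    rw [Units.val_pow_eq_pow_val]
    exact (LaurentPolynomial.T_pow 1 n).trans (by rw [mul_one])
  obtain ⟨n, rfl | rfl⟩ := n.eq_nat_or_neg
  · rw [zpow_natCast, h]
  · rw [zpow_neg, zpow_natCast, ← inv_pow, Units.val_pow_eq_pow_val]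
    exact (LaurentPolynomial.T_pow (-1) n).trans (by rw [mul_neg_one])

theorem thetaPart₀_laurentUnit :
    thetaPart₀ laurentUnit = gf (fun u => 3 * tri u) fun u => T (3 * u + 0) := by
  simp [thetaPart₀, laurentUnit_zpow]

theorem thetaPart₁_laurentUnit :
    thetaPart₁ laurentUnit = gf (fun u => pent (-u - 1)) fun u => T (3 * u + 1) := by
  simp only [thetaPart₁, laurentUnit_zpow]

theorem thetaPart₂_laurentUnit :
    thetaPart₂ laurentUnit = gf pent fun u => T (3 * u + -1) := by
  simp only [thetaPart₂, laurentUnit_zpow, sub_eq_add_neg]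

theorem constTerm_thetaPart₀_pow : constTerm (thetaPart₀ laurentUnit
    * (thetaPart₀ laurentUnit * thetaPart₀ laurentUnit)) = dilate (hexTheta ℤ) := by
  have h := finFib_tri.const_mul three_pos
  rw [thetaPart₀_laurentUnit, constTerm_mul_three h h h 0 (by norm_num), hexTheta, ← gf_three_mul]
  congr 1
  funext p
  zify
  refine mul_left_cancel₀ (two_ne_zero (α := ℤ)) ?_
  linear_combination 3 * two_mul_tri p.1 + 3 * two_mul_tri p.2
    + 3 * two_mul_tri (-0 - p.1 - p.2) - 6 * cast_hexForm p

theorem constTerm_thetaPart₁_pow : constTerm (thetaPart₁ laurentUnit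
    * (thetaPart₁ laurentUnit * thetaPart₁ laurentUnit))
      = X ^ 2 * dilate (hexCosetTheta ℤ) := by
  have h := finFib_pent_neg
  rw [thetaPart₁_laurentUnit, constTerm_mul_three h h h 1 (by norm_num), hexCosetTheta,
    ← gf_three_mul, ← gf_add_const]
  congr 1
  funext p
  zify
  refine mul_left_cancel₀ (two_ne_zero (α := ℤ)) ?_
  linear_combination two_mul_pent (-p.1 - 1) + two_mul_pent (-p.2 - 1)
    + two_mul_pent (-(-1 - p.1 - p.2) - 1) - 6 * cast_hexCoset p

theorem constTerm_thetaPart₂_pow : constTerm (thetaPart₂ laurentUnit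
    * (thetaPart₂ laurentUnit * thetaPart₂ laurentUnit))
      = X ^ 2 * dilate (hexCosetTheta ℤ) := by
  have h := finFib_pent
  rw [thetaPart₂_laurentUnit, constTerm_mul_three h h h (-1) (by norm_num), hexCosetTheta,
    ← gf_three_mul, ← gf_add_const]
  refine gf_eq_of_bijective (fun p => (-p.1, -p.2)) ?_ ?_ fun _ => rfl
  · exact ⟨fun p q h => by simpa [Prod.ext_iff] using h, fun p => ⟨(-p.1, -p.2), by simp⟩⟩
  · intro p
    zify
    refine mul_left_cancel₀ (two_ne_zero (α := ℤ)) ?_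
    linear_combination two_mul_pent (-p.1) + two_mul_pent (-p.2)
      + two_mul_pent (- -1 - -p.1 - -p.2) - 6 * cast_hexCoset p

/-- The constant term is X times the theta series of `coreForm`, a third of `hexCosetTheta`; the
factor 3 avoids a division and is later absorbed by the multinomial coefficient 6. -/
theorem constTerm_thetaPart_mul : 3 * constTerm (thetaPart₀ laurentUnit
    * (thetaPart₁ laurentUnit * thetaPart₂ laurentUnit)) = X * hexCosetTheta ℤ := by
  rw [thetaPart₀_laurentUnit, thetaPart₁_laurentUnit, thetaPart₂_laurentUnit,
    constTerm_mul_three (finFib_tri.const_mul three_pos) finFib_pent_neg finFib_pent 0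
      (by norm_num), hexCosetTheta_eq_three_mul, mul_left_comm, ← pow_one X, ← gf_add_const]
  congr 1
  symm
  refine gf_eq_of_bijective (fun p : ℤ × ℤ => (-p.2, p.1 + p.2)) ?_ ?_ fun _ => rfl
  · constructor
    · rintro ⟨a, b⟩ ⟨a', b'⟩ h
      simp only [Prod.mk.injEq] at h ⊢
      omega
    · rintro ⟨a, b⟩
      refine ⟨(a + b, -a), ?_⟩
      simp
  · intro p
    zify
    refine mul_left_cancel₀ (two_ne_zero (α := ℤ)) ?_
    linear_combination 2 * cast_coreForm (-p.2, p.1 + p.2) - 3 * two_mul_tri p.1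
      - two_mul_pent (-p.2 - 1) - two_mul_pent (-0 - p.1 - p.2)

/-- The theta series of the root lattice `A₈`, by the cubes of theta series. -/
theorem constTerm_theta_pow_nine : constTerm (theta laurentUnit ^ 9)
    = hexTheta ℤ ^ 3 * dilate (hexTheta ℤ) + 2 * X * hexTheta ℤ * hexCosetTheta ℤ ^ 3
      + 2 * X ^ 2 * hexCosetTheta ℤ ^ 3 * dilate (hexCosetTheta ℤ) := by
  have h0 := finFib_tri.const_mul three_pos
  have h1 := finFib_pent_neg
  have h2 := finFib_pent
  -- The T-exponents in the three parts are 0, 1 and -1 mod 3, so a mixed product has a constant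
  -- term only if these residues sum to 0 mod 3. This kills all products except the three cubes and
  -- the product of all three parts.
  have e1 : constTerm (thetaPart₀ laurentUnit * (thetaPart₀ laurentUnit
      * thetaPart₁ laurentUnit)) = 0 := by
    rw [thetaPart₀_laurentUnit, thetaPart₁_laurentUnit]
    exact constTerm_mul_three_eq_zero h0 h0 h1 (by norm_num)
  have e2 : constTerm (thetaPart₀ laurentUnit * (thetaPart₀ laurentUnit
      * thetaPart₂ laurentUnit)) = 0 := by
    rw [thetaPart₀_laurentUnit, thetaPart₂_laurentUnit]
    exact constTerm_mul_three_eq_zero h0 h0 h2 (by norm_num)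
  have e3 : constTerm (thetaPart₀ laurentUnit * (thetaPart₁ laurentUnit
      * thetaPart₁ laurentUnit)) = 0 := by
    rw [thetaPart₀_laurentUnit, thetaPart₁_laurentUnit]
    exact constTerm_mul_three_eq_zero h0 h1 h1 (by norm_num)
  have e4 : constTerm (thetaPart₀ laurentUnit * (thetaPart₂ laurentUnit
      * thetaPart₂ laurentUnit)) = 0 := by
    rw [thetaPart₀_laurentUnit, thetaPart₂_laurentUnit]
    exact constTerm_mul_three_eq_zero h0 h2 h2 (by norm_num)
  have e5 : constTerm (thetaPart₁ laurentUnit * (thetaPart₁ laurentUnit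
      * thetaPart₂ laurentUnit)) = 0 := by
    rw [thetaPart₁_laurentUnit, thetaPart₂_laurentUnit]
    exact constTerm_mul_three_eq_zero h1 h1 h2 (by norm_num)
  have e6 : constTerm (thetaPart₁ laurentUnit * (thetaPart₂ laurentUnit
      * thetaPart₂ laurentUnit)) = 0 := by
    rw [thetaPart₁_laurentUnit, thetaPart₂_laurentUnit]
    exact constTerm_mul_three_eq_zero h1 h2 h2 (by norm_num)
  have hexp : theta laurentUnit ^ 9
      = toLaurentSeries (hexTheta ℤ ^ 3) * (thetaPart₀ laurentUnit
          * (thetaPart₀ laurentUnit * thetaPart₀ laurentUnit))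
        + toLaurentSeries (3 * hexTheta ℤ ^ 2 * hexCosetTheta ℤ) * (thetaPart₀ laurentUnit
          * (thetaPart₀ laurentUnit * thetaPart₁ laurentUnit))
        + toLaurentSeries (3 * hexTheta ℤ ^ 2 * hexCosetTheta ℤ) * (thetaPart₀ laurentUnit
          * (thetaPart₀ laurentUnit * thetaPart₂ laurentUnit))
        + toLaurentSeries (3 * hexTheta ℤ * hexCosetTheta ℤ ^ 2) * (thetaPart₀ laurentUnit
          * (thetaPart₁ laurentUnit * thetaPart₁ laurentUnit))
        + toLaurentSeries (6 * hexTheta ℤ * hexCosetTheta ℤ ^ 2) * (thetaPart₀ laurentUnit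
          * (thetaPart₁ laurentUnit * thetaPart₂ laurentUnit))
        + toLaurentSeries (3 * hexTheta ℤ * hexCosetTheta ℤ ^ 2) * (thetaPart₀ laurentUnit
          * (thetaPart₂ laurentUnit * thetaPart₂ laurentUnit))
        + toLaurentSeries (hexCosetTheta ℤ ^ 3) * (thetaPart₁ laurentUnit
          * (thetaPart₁ laurentUnit * thetaPart₁ laurentUnit))
        + toLaurentSeries (3 * hexCosetTheta ℤ ^ 3) * (thetaPart₁ laurentUnit
          * (thetaPart₁ laurentUnit * thetaPart₂ laurentUnit))
        + toLaurentSeries (3 * hexCosetTheta ℤ ^ 3) * (thetaPart₁ laurentUnit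
          * (thetaPart₂ laurentUnit * thetaPart₂ laurentUnit))
        + toLaurentSeries (hexCosetTheta ℤ ^ 3) * (thetaPart₂ laurentUnit
          * (thetaPart₂ laurentUnit * thetaPart₂ laurentUnit)) := by
    rw [show 9 = 3 * 3 by rfl, pow_mul, theta_pow_three]
    simp only [map_mul, map_pow, map_ofNat, map_hexTheta, map_hexCosetTheta]
    ring
  rw [hexp]
  simp only [map_add, constTerm_map_mul, e1, e2, e3, e4, e5, e6, constTerm_thetaPart₀_pow,
    constTerm_thetaPart₁_pow, constTerm_thetaPart₂_pow]
  linear_combination 2 * hexTheta ℤ * hexCosetTheta ℤ ^ 2 * constTerm_thetaPart_mul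

end constantTerm

/-! ### Frobenius partitions as a constant term -/

section counting

open LaurentPolynomial (T)

/-- The `k`-colored integers with value less than `M`. -/
def coloredBox (M k : ℕ) : Finset (ColoredNat k) :=
  (Finset.range M ×ˢ Finset.univ).map toLex.toEmbedding

theorem mem_coloredBox {M k : ℕ} {a : ColoredNat k} : a ∈ coloredBox M k ↔ a.value < M := by
  simp only [coloredBox, Finset.mem_map_equiv, Finset.mem_product, Finset.mem_range,
    Finset.mem_univ, and_true]
  rfl

theorem prod_coloredBox {R : Type*} [CommMonoid R] (M k : ℕ) (g : ℕ → R) :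
    ∏ a ∈ coloredBox M k, g a.value = (∏ n ∈ Finset.range M, g n) ^ k := by
  rw [coloredBox, Finset.prod_map, Finset.prod_product, ← Finset.prod_pow]
  refine Finset.prod_congr rfl fun n _ => ?_
  change ∏ _c : Fin k, g n = _
  rw [Finset.prod_const, Finset.card_univ, Fintype.card_fin]

theorem prod_coloredBox_one_add (M k : ℕ) (e : ℕ → ℕ) (m : ℤ) :
    ∏ a ∈ coloredBox M k, (1 + C (T m : LaurentPolynomial ℤ) * X ^ e a.value)
      = ∑ S ∈ (coloredBox M k).powerset,
        C (T (S.card * m) : LaurentPolynomial ℤ) * X ^ (∑ a ∈ S, e a.value) := by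
  rw [Finset.prod_one_add]
  refine Finset.sum_congr rfl fun S _ => ?_
  rw [Finset.prod_mul_distrib, Finset.prod_const, Finset.prod_pow_eq_pow_sum, ← map_pow,
    LaurentPolynomial.T_pow]

/-- The pairs of sets that are the rows of a `k`-colored Frobenius partition of `N`. -/
def frobeniusRows (M k N : ℕ) : Finset (Finset (ColoredNat k) × Finset (ColoredNat k)) :=
  ((coloredBox M k).powerset ×ˢ (coloredBox M k).powerset).filter fun p =>
    p.1.card = p.2.card ∧ ∑ a ∈ p.1, (a.value + 1) + ∑ a ∈ p.2, a.value = N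

theorem cphi_eq_card {M k N : ℕ} (h : N < M) : cphi k N = (frobeniusRows M k N).card := by
  classical
  have hnd : ∀ {l : List (ColoredNat k)}, l.Pairwise (· > ·) → l.Nodup :=
    fun hl => hl.imp ne_of_gt
  have hsum : ∀ {l : List (ColoredNat k)}, l.Pairwise (· > ·) →
      ∑ a ∈ l.toFinset, a.value = (l.map ColoredNat.value).sum :=
    fun hl => List.sum_toFinset _ (hnd hl)
  have hsize : ∀ F : ColoredFrobeniusPartition k, ∑ a ∈ F.top.toFinset, (a.value + 1)
      + ∑ a ∈ F.bottom.toFinset, a.value = F.size := by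
    intro F
    rw [Finset.sum_add_distrib, hsum F.top_decreasing, hsum F.bottom_decreasing,
      Finset.sum_const, List.toFinset_card_of_nodup (hnd F.top_decreasing), smul_eq_mul, mul_one,
      ColoredFrobeniusPartition.size]
    ring
  have hle : ∀ (S : Finset (ColoredNat k)) (a : ColoredNat k), a ∈ S →
      a.value ≤ ∑ a ∈ S, a.value := fun S a ha =>
    Finset.single_le_sum (f := ColoredNat.value) (fun _ _ => Nat.zero_le _) ha
  have hle' : ∀ (S : Finset (ColoredNat k)) (a : ColoredNat k), a ∈ S →
      a.value ≤ ∑ a ∈ S, (a.value + 1) := fun S a ha =>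
    (hle S a ha).trans (Finset.sum_le_sum fun _ _ => Nat.le_succ _)
  rw [cphi, ← Nat.card_eq_finsetCard]
  refine Nat.card_eq_of_bijective (fun F => ⟨(F.1.top.toFinset, F.1.bottom.toFinset), ?_⟩) ⟨?_, ?_⟩
  · have h1 := hsize F.1
    rw [F.2] at h1
    simp only [frobeniusRows, Finset.mem_filter, Finset.mem_product, Finset.mem_powerset]
    refine ⟨⟨fun a ha => ?_, fun a ha => ?_⟩, ?_, h1⟩
    · have := hle' _ a ha
      exact mem_coloredBox.2 (by omega)
    · have := hle _ a ha
      exact mem_coloredBox.2 (by omega)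
    · rw [List.toFinset_card_of_nodup (hnd F.1.top_decreasing),
        List.toFinset_card_of_nodup (hnd F.1.bottom_decreasing), F.1.length_eq]
  · intro F G hFG
    have hinj : ∀ l m : List (ColoredNat k), l.Pairwise (· > ·) → m.Pairwise (· > ·) →
        l.toFinset = m.toFinset → l = m := fun l m hl hm h =>
      (List.perm_of_nodup_nodup_toFinset_eq (hnd hl) (hnd hm)
        h).eq_of_pairwise (fun a b _ _ h1 h2 => absurd h1 (not_lt_of_gt h2)) hl hm
    simp only [Subtype.mk.injEq, Prod.mk.injEq] at hFG
    exact Subtype.ext (ColoredFrobeniusPartition.ext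
      (hinj _ _ F.1.top_decreasing G.1.top_decreasing hFG.1)
      (hinj _ _ F.1.bottom_decreasing G.1.bottom_decreasing hFG.2))
  · rintro ⟨⟨S, S'⟩, hS⟩
    simp only [frobeniusRows, Finset.mem_filter] at hS
    let F : ColoredFrobeniusPartition k :=
      { top := S.sort (· ≥ ·)
        bottom := S'.sort (· ≥ ·)
        length_eq := by rw [Finset.length_sort, Finset.length_sort, hS.2.1]
        top_decreasing := (Finset.sortedGT_sort S).pairwise
        bottom_decreasing := (Finset.sortedGT_sort S').pairwise }
    have h1 : F.top.toFinset = S := Finset.sort_toFinset _ _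
    have h2 : F.bottom.toFinset = S' := Finset.sort_toFinset _ _
    refine ⟨⟨F, ?_⟩, ?_⟩
    · rw [← hsize, h1, h2, hS.2.2]
    · simp only [h1, h2]

/-- A top entry a contributes T X^(a+1) and a bottom entry b contributes T⁻¹ X^b. The constant term
in T forces rows of equal length, and the extra 1 per top entry accounts for the summand r. As N <
M, cutting off at M loses nothing. -/
theorem coeff_constTerm_jacobiProd_pow {M k N : ℕ} (h : N < M) :
    coeff N (constTerm (jacobiProd laurentUnit M ^ k)) = (cphi k N : ℤ) := by
  classical
  have e1 : ((laurentUnit : (LaurentPolynomial ℤ)ˣ) : LaurentPolynomial ℤ) = T 1 := rfl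
  have e2 : ((laurentUnit⁻¹ : (LaurentPolynomial ℤ)ˣ) : LaurentPolynomial ℤ) = T (-1) := rfl
  rw [jacobiProd, e1, e2, Finset.prod_mul_distrib, mul_pow,
    ← prod_coloredBox M k fun n => 1 + C (T 1 : LaurentPolynomial ℤ) * X ^ (n + 1),
    ← prod_coloredBox M k fun n => 1 + C (T (-1) : LaurentPolynomial ℤ) * X ^ n,
    prod_coloredBox_one_add M k (fun n => n + 1), prod_coloredBox_one_add M k (fun n => n),
    Finset.sum_mul_sum, ← Finset.sum_product', cphi_eq_card h, frobeniusRows, map_sum, map_sum,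
    Finset.card_filter, Nat.cast_sum]
  refine Finset.sum_congr rfl fun p _ => ?_
  rw [mul_mul_mul_comm, ← map_mul, ← pow_add, ← LaurentPolynomial.T_add, coeff_constTerm,
    coeff_C_mul_X_pow]
  have hc : (p.1.card * 1 + p.2.card * -1 : ℤ) = 0 ↔ p.1.card = p.2.card := by omega
  by_cases h1 : N = ∑ a ∈ p.1, (a.value + 1) + ∑ a ∈ p.2, a.value
  · rw [if_pos h1, laurentConst_T]
    simp only [hc, ← h1, and_true, Nat.cast_ite, Nat.cast_one, Nat.cast_zero]
  · rw [if_neg h1, map_zero, if_neg fun h2 => h1 h2.2.symm, Nat.cast_zero]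

/-- The generating function of `k`-colored Frobenius partitions. -/
noncomputable def cphiSeries (k : ℕ) : ℤ⟦X⟧ := PowerSeries.mk fun n => (cphi k n : ℤ)

theorem euler_pow_mul_cphiSeries (k : ℕ) :
    euler ℤ ^ k * cphiSeries k = constTerm (theta laurentUnit ^ k) := by
  refine eq_of_jet_eq fun N => ?_
  have h1 : jet N (theta laurentUnit ^ k)
      = jet N (toLaurentSeries (euler ℤ ^ k) * jacobiProd laurentUnit (3 * N) ^ k) := by
    rw [map_pow (jet N), jet_theta_eq_jacobiProd laurentUnit le_rfl, ← map_pow, mul_pow, map_pow,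
      map_euler]
  have h2 : jet N (cphiSeries k) = jet N (constTerm (jacobiProd laurentUnit (3 * N) ^ k)) := by
    rw [jet_eq_jet_iff]
    intro n hn
    rw [coeff_constTerm_jacobiProd_pow (by omega), cphiSeries, coeff_mk]
  rw [jet_constTerm h1, constTerm_map_mul, map_mul, h2, ← map_mul]

end counting

/-! ### Borwein's cubic theta functions -/

section cubicTheta

/-- The inverse of Euler's product. -/
noncomputable def eulerInv : ℤ⟦X⟧ := ((isUnit_euler ℤ).unit⁻¹ : (ℤ⟦X⟧)ˣ)

theorem euler_mul_eulerInv : euler ℤ * eulerInv = 1 := (isUnit_euler ℤ).mul_val_inv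

theorem dilate_euler_mul_eulerInv : dilate (euler ℤ) * dilate eulerInv = 1 := by
  rw [← map_mul, euler_mul_eulerInv, map_one]

/-- The generating function of 3-cores. -/
noncomputable def coreSeries : ℤ⟦X⟧ := dilate (euler ℤ) ^ 3 * eulerInv

theorem hexCosetTheta_eq : hexCosetTheta ℤ = 3 * coreSeries := by
  rw [coreSeries]
  linear_combination eulerInv * hexCosetTheta_mul_euler
    - hexCosetTheta ℤ * euler_mul_eulerInv

/-- The part of `hexTheta` with exponents divisible by three. -/
noncomputable def thetaX : ℤ⟦X⟧ := dilate (hexTheta ℤ)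

theorem dilate_hexTheta : dilate (hexTheta ℤ) = thetaX := rfl

/-- Half of the part of `hexTheta` with exponents not divisible by three. -/
noncomputable def thetaY : ℤ⟦X⟧ := X * dilate (hexCosetTheta ℤ)

theorem hexTheta_eq : hexTheta ℤ = thetaX + 2 * thetaY := by
  conv_lhs => rw [hexTheta_eq_dilate]
  rw [thetaX, thetaY]
  ring

/-- The cubic theta function `b` of the Borweins. -/
noncomputable def borweinB : ℤ⟦X⟧ := thetaX - thetaY

theorem euler_pow_three_eq : euler ℤ ^ 3 = borweinB * dilate (euler ℤ) := euler_pow_three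

theorem borweinB_eq : borweinB = euler ℤ ^ 3 * dilate eulerInv := by
  rw [euler_pow_three_eq]
  linear_combination (-borweinB) * dilate_euler_mul_eulerInv

theorem dilate_borweinB_eq :
    dilate borweinB = dilate (euler ℤ) ^ 3 * dilate (dilate eulerInv) := by
  rw [borweinB_eq, map_mul, map_pow]

noncomputable def borweinBInv : ℤ⟦X⟧ := dilate (euler ℤ) * eulerInv ^ 3

theorem borweinB_mul_inv : borweinB * borweinBInv = 1 := by
  have h : euler ℤ ^ 3 * eulerInv ^ 3 = 1 := by rw [← mul_pow, euler_mul_eulerInv, one_pow]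
  rw [borweinB_eq, borweinBInv]
  linear_combination h + euler ℤ ^ 3 * eulerInv ^ 3 * dilate_euler_mul_eulerInv

theorem coreSeries_pow_three_mul :
    coreSeries ^ 3 * borweinB = dilate coreSeries * dilate borweinB ^ 3 := by
  have h1 : euler ℤ ^ 3 * eulerInv ^ 3 = 1 := by rw [← mul_pow, euler_mul_eulerInv, one_pow]
  have h2 := dilate_euler_mul_eulerInv
  have h3 : dilate (dilate (euler ℤ)) ^ 3 * dilate (dilate eulerInv) ^ 3 = 1 := by
    rw [← mul_pow, ← map_mul, h2, map_one, one_pow]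
  rw [dilate_borweinB_eq, borweinB_eq, coreSeries, map_mul, map_pow]
  linear_combination dilate (euler ℤ) ^ 9 * dilate eulerInv * h1
    - dilate (euler ℤ) ^ 9 * dilate eulerInv * h3

/-- If Xⁿ divides D, then X^(3n+1) divides the right side, hence D; so D vanishes to every order. -/
theorem eq_zero_of_mul_eq_dilate {D u v : ℤ⟦X⟧} (hu : IsUnit u) (h : D * u = X * v * dilate D) :
    D = 0 := by
  have key : ∀ n, X ^ n ∣ D := by
    intro n
    induction n with
    | zero => simp
    | succ n ih =>
      obtain ⟨f, hf⟩ := ih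
      rw [← hu.dvd_mul_right, h]
      refine ⟨v * (X ^ (2 * n) * dilate f), ?_⟩
      conv_lhs => rw [hf]
      rw [map_mul, map_pow, expand_X]
      ring
  ext n
  exact X_pow_dvd_iff.1 (key (n + 1)) n n.lt_succ_self

/-- The cubic identity `a³ = b³ + c³` of the Borweins. -/
theorem hexTheta_pow_three :
    hexTheta ℤ ^ 3 = borweinB ^ 3 + 27 * X * coreSeries ^ 3 := by
  have hy : thetaY = 3 * X * dilate coreSeries := by
    rw [thetaY, hexCosetTheta_eq, map_mul, map_ofNat]
    ring
  -- The defect D = a³ - b³ - c³ satisfies D b = 9y D(q³): here (a³ - b³) b = 9y (x³ - y³) is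
  -- polynomial algebra, and c³ b = 9y b(q³)³ comes from the eta quotients.
  rw [← sub_eq_zero]
  refine eq_zero_of_mul_eq_dilate (v := 27 * dilate coreSeries)
    (.of_mul_eq_one _ borweinB_mul_inv) ?_
  have hA := hexTheta_eq
  have hb : borweinB = thetaX - thetaY := rfl
  have hd : dilate (hexTheta ℤ ^ 3 - (borweinB ^ 3 + 27 * X * coreSeries ^ 3))
      = thetaX ^ 3 - thetaY ^ 3 - dilate borweinB ^ 3 := by
    rw [hy]
    simp only [map_sub, map_add, map_mul, map_pow, expand_X, map_ofNat, dilate_hexTheta]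
    ring
  rw [hd]
  have h1 : (hexTheta ℤ ^ 3 - borweinB ^ 3) * borweinB = 9 * thetaY * (thetaX ^ 3 - thetaY ^ 3) := by
    rw [hA, hb]
    ring
  linear_combination h1 - 27 * X * coreSeries_pow_three_mul
    + 9 * (thetaX ^ 3 - thetaY ^ 3) * hy

/-- The quadratic factor of `x³ - y³`. -/
noncomputable def thetaQ : ℤ⟦X⟧ := thetaX ^ 2 + thetaX * thetaY + thetaY ^ 2

theorem mul_coreSeries_pow_three : 27 * X * coreSeries ^ 3 = 9 * thetaY * thetaQ := by
  have hb : borweinB = thetaX - thetaY := rfl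
  have h := hexTheta_pow_three
  rw [hexTheta_eq, hb] at h
  rw [thetaQ]
  linear_combination (-1 : ℤ⟦X⟧) * h

theorem thetaY_eq : thetaY = 3 * X * dilate coreSeries := by
  rw [thetaY, hexCosetTheta_eq, map_mul, map_ofNat]
  ring

/-- The left side is x³ - y³, so this is the cubic identity with q replaced by q³. Inverted, it
writes 1/b as a form in x and y times a series in q³. -/
theorem borweinB_mul_thetaQ : borweinB * thetaQ = dilate borweinB ^ 3 := by
  have h := congrArg dilate hexTheta_pow_three
  simp only [map_add, map_mul, map_pow, expand_X, map_ofNat, dilate_hexTheta] at h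
  have h1 : borweinB * thetaQ = thetaX ^ 3 - thetaY ^ 3 := by
    rw [borweinB, thetaQ]
    ring
  rw [h1, thetaY_eq]
  linear_combination h

theorem borweinBInv_eq : borweinBInv = thetaQ * dilate borweinBInv ^ 3 := by
  have h : dilate borweinB ^ 3 * dilate borweinBInv ^ 3 = 1 := by
    rw [← mul_pow, ← map_mul, borweinB_mul_inv, map_one, one_pow]
  linear_combination (-borweinBInv) * h - borweinBInv * dilate borweinBInv ^ 3 * borweinB_mul_thetaQ
    + thetaQ * dilate borweinBInv ^ 3 * borweinB_mul_inv

/-- The modular function `c³ / b³`. -/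
noncomputable def cubicRatio : ℤ⟦X⟧ := 27 * X * coreSeries ^ 3 * borweinBInv ^ 3

theorem cubicRatio_eq : cubicRatio
    = 9 * (thetaY * thetaQ ^ 4 * dilate borweinBInv ^ 9) := by
  have h : borweinBInv ^ 3 = (thetaQ * dilate borweinBInv ^ 3) ^ 3 := by
    conv_lhs => rw [borweinBInv_eq]
  rw [cubicRatio, mul_coreSeries_pow_three, h]
  ring

theorem hexTheta_pow_three_eq : hexTheta ℤ ^ 3 = borweinB ^ 3 * (1 + cubicRatio) := by
  have h : borweinB ^ 3 * borweinBInv ^ 3 = 1 := by rw [← mul_pow, borweinB_mul_inv, one_pow]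
  rw [hexTheta_pow_three, cubicRatio]
  linear_combination (-27 * X * coreSeries ^ 3) * h

theorem X_mul_hexCosetTheta_pow_three :
    X * hexCosetTheta ℤ ^ 3 = borweinB ^ 3 * cubicRatio := by
  have h : borweinB ^ 3 * borweinBInv ^ 3 = 1 := by rw [← mul_pow, borweinB_mul_inv, one_pow]
  rw [hexCosetTheta_eq, cubicRatio]
  linear_combination (-27 * X * coreSeries ^ 3) * h

end cubicTheta

/-! ### Trisection of binary forms in x and y -/

section sections

/-- The operator `∑ a(n) Xⁿ ↦ ∑ a(3n + j) Xⁿ`. -/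
noncomputable def trisect (j : ℕ) : ℤ⟦X⟧ →+ ℤ⟦X⟧ where
  toFun F := PowerSeries.mk fun n => coeff (3 * n + j) F
  map_zero' := by ext; simp
  map_add' F G := by ext; simp

theorem coeff_trisect (j n : ℕ) (F : ℤ⟦X⟧) :
    coeff n (trisect j F) = coeff (3 * n + j) F :=
  coeff_mk n fun n => coeff (3 * n + j) F

theorem trisect_dilate_mul {j : ℕ} (hj : j < 3) (f F : ℤ⟦X⟧) :
    trisect j (dilate f * F) = f * trisect j F := by
  ext n
  rw [coeff_trisect, coeff_mul, coeff_mul]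
  symm
  refine Finset.sum_of_injOn (fun p => (3 * p.1, 3 * p.2 + j)) ?_ ?_ ?_ ?_
  · rintro ⟨a, b⟩ _ ⟨a', b'⟩ _ h
    simp only [Prod.mk.injEq] at h ⊢
    omega
  · rintro ⟨a, b⟩ h
    simp only [Finset.mem_coe, Finset.HasAntidiagonal.mem_antidiagonal] at h ⊢
    omega
  · rintro ⟨a, b⟩ h h2
    rw [Finset.HasAntidiagonal.mem_antidiagonal] at h
    simp only at h
    rw [coeff_expand, if_neg, zero_mul]
    rintro ⟨c, rfl⟩
    refine h2 ⟨(c, n - c), ?_, ?_⟩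
    · simp only [Finset.mem_coe, Finset.HasAntidiagonal.mem_antidiagonal]
      omega
    · simp only [Prod.mk.injEq, true_and]
      omega
  · rintro ⟨a, b⟩ _
    rw [coeff_expand_mul, coeff_trisect]

theorem trisect_X_pow {j : ℕ} (hj : j < 3) (l : ℕ) :
    trisect j (X ^ l) = if l % 3 = j then X ^ (l / 3) else 0 := by
  ext n
  rw [coeff_trisect, coeff_X_pow]
  split_ifs with h1 h2 h2
  · rw [coeff_X_pow, if_pos (by omega)]
  · omega
  · rw [coeff_X_pow, if_neg (by omega)]
  · rw [map_zero]

/-- Since x is a series in q³ and y is q times one, a monomial lives in the single residue class of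
its y-degree. -/
theorem trisect_thetaX_mul_thetaY {j : ℕ} (hj : j < 3) (i l : ℕ) :
    trisect j (thetaX ^ i * thetaY ^ l)
      = if l % 3 = j then hexTheta ℤ ^ i * hexCosetTheta ℤ ^ l * X ^ (l / 3) else 0 := by
  have h : thetaX ^ i * thetaY ^ l = dilate (hexTheta ℤ ^ i * hexCosetTheta ℤ ^ l) * X ^ l := by
    rw [thetaX, thetaY, map_mul, map_pow, map_pow]
    ring
  rw [h, trisect_dilate_mul hj, trisect_X_pow hj]
  split_ifs <;> simp

/-- The binary forms of degree `n` in `thetaX` and `thetaY`. -/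
noncomputable def thetaForm (n : ℕ) : AddSubgroup ℤ⟦X⟧ :=
  AddSubgroup.closure {F | ∃ i l, i + l = n ∧ F = thetaX ^ i * thetaY ^ l}

theorem thetaForm_mul {m n : ℕ} {f g : ℤ⟦X⟧} (hf : f ∈ thetaForm m) (hg : g ∈ thetaForm n) :
    f * g ∈ thetaForm (m + n) := by
  induction hf using AddSubgroup.closure_induction with
  | mem f hf =>
    obtain ⟨i, l, hil, rfl⟩ := hf
    induction hg using AddSubgroup.closure_induction with
    | mem g hg =>
      obtain ⟨i', l', hil', rfl⟩ := hg
      exact AddSubgroup.subset_closure ⟨i + i', l + l', by omega, by ring⟩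
    | zero => rw [mul_zero]; exact zero_mem _
    | add g g' _ _ h h' => rw [mul_add]; exact add_mem h h'
    | neg g _ h => rw [mul_neg]; exact neg_mem h
  | zero => rw [zero_mul]; exact zero_mem _
  | add f f' _ _ h h' => rw [add_mul]; exact add_mem h h'
  | neg f _ h => rw [neg_mul]; exact neg_mem h

theorem monomial_mem_thetaForm (i l : ℕ) : thetaX ^ i * thetaY ^ l ∈ thetaForm (i + l) :=
  AddSubgroup.subset_closure ⟨i, l, rfl, rfl⟩

theorem thetaForm_pow {m : ℕ} {f : ℤ⟦X⟧} (hf : f ∈ thetaForm m) (k : ℕ) :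
    f ^ k ∈ thetaForm (m * k) := by
  induction k with
  | zero => simpa using monomial_mem_thetaForm 0 0
  | succ k ih => rw [pow_succ]; exact thetaForm_mul ih hf

theorem thetaX_mem : thetaX ∈ thetaForm 1 := by simpa using monomial_mem_thetaForm 1 0

theorem thetaY_mem : thetaY ∈ thetaForm 1 := by simpa using monomial_mem_thetaForm 0 1

theorem intCast_mul_mem {S : AddSubgroup ℤ⟦X⟧} {f : ℤ⟦X⟧} (c : ℤ) (hf : f ∈ S) :
    (c : ℤ⟦X⟧) * f ∈ S := by
  rw [← zsmul_eq_mul]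
  exact S.zsmul_mem hf c

theorem hexTheta_mem : hexTheta ℤ ∈ thetaForm 1 := by
  rw [hexTheta_eq]
  exact add_mem thetaX_mem (intCast_mul_mem 2 thetaY_mem)

theorem thetaQ_mem : thetaQ ∈ thetaForm 2 := by
  have h1 : thetaX ^ 2 ∈ thetaForm 2 := by simpa using monomial_mem_thetaForm 2 0
  have h2 : thetaX * thetaY ∈ thetaForm 2 := by simpa using monomial_mem_thetaForm 1 1
  have h3 : thetaY ^ 2 ∈ thetaForm 2 := by simpa using monomial_mem_thetaForm 0 2
  rw [thetaQ]
  exact add_mem (add_mem h1 h2) h3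

/-- The ring of integral polynomials in `cubicRatio`. -/
noncomputable def ratioRing : Subring ℤ⟦X⟧ :=
  (Polynomial.eval₂RingHom (Int.castRingHom ℤ⟦X⟧) cubicRatio).range

theorem cubicRatio_mem : cubicRatio ∈ ratioRing := ⟨Polynomial.X, by simp⟩

/-- The series `G * p` with `p` an integral polynomial in `cubicRatio`. -/
noncomputable def ratioSpan (G : ℤ⟦X⟧) : AddSubgroup ℤ⟦X⟧ :=
  ratioRing.toAddSubgroup.map (AddMonoidHom.mulLeft G)

theorem mem_ratioSpan {G F : ℤ⟦X⟧} : F ∈ ratioSpan G ↔ ∃ p ∈ ratioRing, G * p = F := Iff.rfl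

theorem map_mem_of_ratioSpan (L : ℤ⟦X⟧ →+ ℤ⟦X⟧) (S : AddSubgroup ℤ⟦X⟧) {G : ℤ⟦X⟧}
    (h : ∀ i, L (G * cubicRatio ^ i) ∈ S) {F : ℤ⟦X⟧} (hF : F ∈ ratioSpan G) : L F ∈ S := by
  obtain ⟨p, ⟨q, rfl⟩, rfl⟩ := mem_ratioSpan.1 hF
  clear hF
  rw [Polynomial.coe_eval₂RingHom]
  induction q using Polynomial.induction_on' with
  | add p q hp hq => rw [Polynomial.eval₂_add, mul_add, map_add]; exact add_mem hp hq
  | monomial n a =>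
    rw [Polynomial.eval₂_monomial, mul_left_comm, eq_intCast, ← zsmul_eq_mul, map_zsmul]
    exact S.zsmul_mem (h n) a

/-- A surviving monomial has y-degree 3m + 2, and the total degree then makes its x-degree 3e + 1.
Trisection gives a c² (a³)ᵉ (qc³)ᵐ, and both cubes are b³ times a polynomial in r. -/
theorem trisect_two_form {d : ℕ} {F : ℤ⟦X⟧} (hF : F ∈ thetaForm (3 * d + 3)) :
    trisect 2 F ∈ ratioSpan (hexTheta ℤ * hexCosetTheta ℤ ^ 2 * borweinB ^ (3 * d)) := by
  refine (AddSubgroup.closure_le (K := (ratioSpan _).comap (trisect 2))).2 ?_ hF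
  rintro _ ⟨i, l, hil, rfl⟩
  rw [SetLike.mem_coe, AddSubgroup.mem_comap, trisect_thetaX_mul_thetaY (by norm_num)]
  split_ifs with h
  · obtain ⟨m, rfl⟩ : ∃ m, l = 3 * m + 2 := ⟨l / 3, by omega⟩
    obtain ⟨e, rfl⟩ : ∃ e, i = 3 * e + 1 := ⟨i / 3, by omega⟩
    obtain rfl : d = e + m := by omega
    refine mem_ratioSpan.2 ⟨(1 + cubicRatio) ^ e * cubicRatio ^ m, mul_mem
      (pow_mem (add_mem (one_mem _) cubicRatio_mem) _) (pow_mem cubicRatio_mem _), ?_⟩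
    have h1 : (3 * m + 2) / 3 = m := by omega
    rw [h1, mul_add, pow_add, pow_mul borweinB, pow_mul borweinB, pow_add, pow_add, pow_mul,
      pow_mul, hexTheta_pow_three_eq]
    have h2 := congrArg (· ^ m) X_mul_hexCosetTheta_pow_three
    simp only [mul_pow] at h2 ⊢
    linear_combination (-hexTheta ℤ * hexCosetTheta ℤ ^ 2 * (borweinB ^ 3) ^ e
      * (1 + cubicRatio) ^ e) * h2
  · exact zero_mem _

theorem trisect_zero_form {d : ℕ} {F : ℤ⟦X⟧} (hF : F ∈ thetaForm (3 * d + 1)) :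
    trisect 0 F ∈ ratioSpan (hexTheta ℤ * borweinB ^ (3 * d)) := by
  refine (AddSubgroup.closure_le (K := (ratioSpan _).comap (trisect 0))).2 ?_ hF
  rintro _ ⟨i, l, hil, rfl⟩
  rw [SetLike.mem_coe, AddSubgroup.mem_comap, trisect_thetaX_mul_thetaY (by norm_num)]
  split_ifs with h
  · obtain ⟨m, rfl⟩ : ∃ m, l = 3 * m := ⟨l / 3, by omega⟩
    obtain ⟨e, rfl⟩ : ∃ e, i = 3 * e + 1 := ⟨i / 3, by omega⟩
    obtain rfl : d = e + m := by omega
    refine mem_ratioSpan.2 ⟨(1 + cubicRatio) ^ e * cubicRatio ^ m, mul_mem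
      (pow_mem (add_mem (one_mem _) cubicRatio_mem) _) (pow_mem cubicRatio_mem _), ?_⟩
    have h1 : 3 * m / 3 = m := by omega
    rw [h1, mul_add, pow_add, pow_mul borweinB, pow_mul borweinB, pow_add, pow_mul,
      pow_mul, hexTheta_pow_three_eq]
    have h2 := congrArg (· ^ m) X_mul_hexCosetTheta_pow_three
    simp only [mul_pow] at h2 ⊢
    linear_combination (-hexTheta ℤ * (borweinB ^ 3) ^ e * (1 + cubicRatio) ^ e) * h2
  · exact zero_mem _

/-- Each surviving monomial contains at least c², and c = 3 `coreSeries`. Unlike `trisect_two_form`,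
no condition on the degree is needed. -/
theorem nine_dvd_trisect_two_form {n : ℕ} {F : ℤ⟦X⟧} (hF : F ∈ thetaForm n) :
    9 ∣ trisect 2 F := by
  have h9 : ∀ G : ℤ⟦X⟧, 9 ∣ G ↔ G ∈ (Ideal.span {(9 : ℤ⟦X⟧)}).toAddSubgroup := fun G =>
    Ideal.mem_span_singleton.symm
  rw [h9]
  refine (AddSubgroup.closure_le (K := (Ideal.span {(9 : ℤ⟦X⟧)}).toAddSubgroup.comap
    (trisect 2))).2 ?_ hF
  rintro _ ⟨i, l, hil, rfl⟩
  rw [SetLike.mem_coe, AddSubgroup.mem_comap, trisect_thetaX_mul_thetaY (by norm_num), ← h9]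
  split_ifs with h
  · obtain ⟨m, rfl⟩ : ∃ m, l = m + 2 := ⟨l - 2, by omega⟩
    refine ⟨hexTheta ℤ ^ i * (hexCosetTheta ℤ ^ m * coreSeries ^ 2) * X ^ ((m + 2) / 3), ?_⟩
    rw [pow_add, hexCosetTheta_eq]
    ring
  · exact dvd_zero _

end sections

/-! ### Action of the trisections on the multipliers H, G, K -/

section hecke

theorem ratioSpan_mul_le (m : ℤ⟦X⟧) (k : ℤ) (G : ℤ⟦X⟧) :
    ratioSpan (m * k * G) ≤ ratioSpan (m * G) := by
  intro F hF
  obtain ⟨p, hp, rfl⟩ := mem_ratioSpan.1 hF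
  exact mem_ratioSpan.2 ⟨k * p, mul_mem (intCast_mem _ k) hp, by ring⟩

/-- Both b⁻¹ and r are forms in x and y times series in q³, and the latter pass through the
trisection. Each r brings a factor 9. -/
theorem trisect_dilate_mul_ratio {j : ℕ} (hj : j < 3) (G : ℤ⟦X⟧) (e i : ℕ) :
    trisect j (dilate G * (hexTheta ℤ * borweinBInv ^ e * cubicRatio ^ i))
      = G * borweinBInv ^ (3 * e + 9 * i) * 9 ^ i
        * trisect j (hexTheta ℤ * (thetaQ ^ (e + 4 * i) * thetaY ^ i)) := by
  rw [← trisect_dilate_mul hj]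
  congr 1
  have h : borweinBInv ^ e = thetaQ ^ e * dilate borweinBInv ^ (3 * e) := by
    conv_lhs => rw [borweinBInv_eq, mul_pow, ← pow_mul]
  rw [h, cubicRatio_eq]
  simp only [map_mul, map_pow, map_ofNat]
  ring

theorem hexTheta_mul_form_mem (e i : ℕ) :
    hexTheta ℤ * (thetaQ ^ e * thetaY ^ i) ∈ thetaForm (1 + (2 * e + i)) := by
  have h := thetaForm_pow thetaY_mem i
  rw [one_mul] at h
  exact thetaForm_mul hexTheta_mem (thetaForm_mul (thetaForm_pow thetaQ_mem e) h)

theorem borweinB_pow_mul_inv_pow (n : ℕ) : borweinB ^ n * borweinBInv ^ n = 1 := by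
  rw [← mul_pow, borweinB_mul_inv, one_pow]

/-- The exponent 3c + 1 of 1/b makes the degree of the form divisible by 3, as `trisect_two_form`
requires. Of the power of 9, i factors come from rⁱ and one from c². -/
theorem trisect_two_mem (G : ℤ⟦X⟧) (c i : ℕ) :
    trisect 2 (dilate G * (hexTheta ℤ * borweinBInv ^ (3 * c + 1) * cubicRatio ^ i))
      ∈ ratioSpan (9 ^ (i + 1) * (G * coreSeries ^ 2 * hexTheta ℤ * borweinBInv ^ (3 * c + 3))) := by
  have h := hexTheta_mul_form_mem (3 * c + 1 + 4 * i) i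
  have hd : 1 + (2 * (3 * c + 1 + 4 * i) + i) = 3 * (3 * i + 2 * c) + 3 := by ring
  rw [hd] at h
  obtain ⟨p, hp, h⟩ := mem_ratioSpan.1 (trisect_two_form h)
  rw [trisect_dilate_mul_ratio (by norm_num), ← h, hexCosetTheta_eq]
  refine mem_ratioSpan.2 ⟨p, hp, ?_⟩
  have he : 3 * (3 * c + 1) + 9 * i = 3 * (3 * i + 2 * c) + (3 * c + 3) := by ring
  rw [he, pow_add borweinBInv (3 * (3 * i + 2 * c))]
  linear_combination (-9 ^ (i + 1) * (G * coreSeries ^ 2 * hexTheta ℤ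
    * borweinBInv ^ (3 * c + 3)) * p) * borweinB_pow_mul_inv_pow (3 * (3 * i + 2 * c))

/-- The eta quotient multiplier before the first application of `U₃`. -/
noncomputable def multH : ℤ⟦X⟧ := hexTheta ℤ * eulerInv ^ 3

/-- The multiplier for the even powers of three. -/
noncomputable def multG : ℤ⟦X⟧ := eulerInv * coreSeries ^ 2 * hexTheta ℤ * borweinBInv ^ 3

/-- The multiplier for the odd powers of three. -/
noncomputable def multK : ℤ⟦X⟧ := euler ℤ ^ 5 * coreSeries ^ 2 * hexTheta ℤ * borweinBInv ^ 6

theorem euler_pow_mul_eulerInv_pow (n : ℕ) : euler ℤ ^ n * eulerInv ^ n = 1 := by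
  rw [← mul_pow, euler_mul_eulerInv, one_pow]

theorem multH_eq : multH = dilate eulerInv * (hexTheta ℤ * borweinBInv) := by
  rw [multH, borweinBInv]
  linear_combination (-hexTheta ℤ * eulerInv ^ 3) * dilate_euler_mul_eulerInv

theorem multG_eq : multG = dilate (euler ℤ ^ 5) * (hexTheta ℤ * borweinBInv ^ 4) := by
  have h : borweinBInv ^ 4 = borweinBInv ^ 3 * (dilate (euler ℤ) * eulerInv ^ 3) := by
    rw [pow_succ]; rfl
  rw [multG, h, coreSeries, map_pow]
  ring

theorem multK_eq : multK = dilate (euler ℤ ^ 7) * (hexTheta ℤ * borweinBInv ^ 5) := by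
  have h : borweinBInv ^ 6 = borweinBInv ^ 5 * (dilate (euler ℤ) * eulerInv ^ 3) := by
    rw [pow_succ]; rfl
  rw [multK, h, coreSeries, map_pow]
  linear_combination (dilate (euler ℤ) ^ 7 * hexTheta ℤ * borweinBInv ^ 5)
    * euler_pow_mul_eulerInv_pow 5

theorem X_mul_multK : 27 * X * multK = multH * cubicRatio := by
  have h : borweinBInv ^ 6 = borweinBInv ^ 3 * (dilate (euler ℤ) * eulerInv ^ 3) ^ 3 := by
    change _ = borweinBInv ^ 3 * borweinBInv ^ 3
    ring
  rw [multK, multH, h, cubicRatio, coreSeries]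
  linear_combination (27 * X * dilate (euler ℤ) ^ 9 * hexTheta ℤ * borweinBInv ^ 3
    * eulerInv ^ 6) * euler_pow_mul_eulerInv_pow 5

theorem trisect_two_multH (i : ℕ) :
    trisect 2 (multH * cubicRatio ^ i) ∈ ratioSpan (9 ^ (i + 1) * multG) := by
  have h := trisect_two_mem eulerInv 0 i
  have e : multH * cubicRatio ^ i
      = dilate eulerInv * (hexTheta ℤ * borweinBInv ^ (3 * 0 + 1) * cubicRatio ^ i) := by
    rw [multH_eq]
    ring
  rw [e]
  exact h

/-- The general bound gives only 9 when no r is present; the missing 3 is the coefficient of xy² in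
aQ = (x + 2y)(x² + xy + y²). -/
theorem trisect_two_multH_zero : trisect 2 multH = 27 * multG := by
  have h := trisect_dilate_mul_ratio (j := 2) (by norm_num) eulerInv 1 0
  simp only [pow_one, pow_zero, mul_one, mul_zero, add_zero, ← multH_eq] at h
  have hQ : hexTheta ℤ * thetaQ = thetaX ^ 3 * thetaY ^ 0 + (thetaX ^ 2 * thetaY ^ 1
      + (thetaX ^ 2 * thetaY ^ 1 + thetaX ^ 2 * thetaY ^ 1)) + (thetaX ^ 1 * thetaY ^ 2
      + (thetaX ^ 1 * thetaY ^ 2 + thetaX ^ 1 * thetaY ^ 2))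
      + (thetaX ^ 0 * thetaY ^ 3 + thetaX ^ 0 * thetaY ^ 3) := by
    rw [hexTheta_eq, thetaQ]
    ring
  rw [h, hQ]
  simp only [map_add, trisect_thetaX_mul_thetaY (show 2 < 3 by norm_num)]
  norm_num
  rw [multG, hexCosetTheta_eq]
  ring

theorem trisect_two_of_mem_multH {F : ℤ⟦X⟧} (hF : F ∈ ratioSpan multH) :
    trisect 2 F ∈ ratioSpan (27 * multG) := by
  refine map_mem_of_ratioSpan _ _ (fun i => ?_) hF
  rcases i with _ | i
  · rw [pow_zero, mul_one, trisect_two_multH_zero]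
    exact mem_ratioSpan.2 ⟨1, one_mem _, mul_one _⟩
  · have h := trisect_two_multH (i + 1)
    have e : (9 : ℤ⟦X⟧) ^ (i + 1 + 1) = 27 * ((3 * 9 ^ i : ℤ) : ℤ⟦X⟧) := by push_cast; ring
    rw [e] at h
    exact ratioSpan_mul_le _ _ _ h

theorem trisect_two_X_mul (F : ℤ⟦X⟧) : trisect 2 (X * F) = trisect 1 F := by
  ext n
  rw [coeff_trisect, coeff_trisect]
  exact coeff_succ_X_mul (3 * n + 1) F

theorem natCast_mul_cancel {n : ℕ} (hn : n ≠ 0) {f g : ℤ⟦X⟧}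
    (h : (n : ℤ⟦X⟧) * f = n * g) : f = g := by
  refine mul_left_cancel₀ (fun h0 => hn ?_) h
  simpa using congrArg constantCoeff h0

/-- The relation 27qK = Hr moves the question to the class 2 mod 3 of H rⁱ⁺¹, where at least 9² is
available; dividing by 27 leaves 3. -/
theorem trisect_one_of_mem_multK {F : ℤ⟦X⟧} (hF : F ∈ ratioSpan multK) :
    trisect 1 F ∈ ratioSpan (3 * multG) := by
  refine map_mem_of_ratioSpan _ _ (fun i => ?_) hF
  obtain ⟨p, hp, h⟩ := mem_ratioSpan.1 (trisect_two_multH (i + 1))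
  refine mem_ratioSpan.2 ⟨((9 ^ i : ℤ) : ℤ⟦X⟧) * p, mul_mem (intCast_mem _ _) hp, ?_⟩
  refine natCast_mul_cancel (n := 27) (by norm_num) ?_
  have e : multH * cubicRatio ^ (i + 1) = dilate 27 * (X * (multK * cubicRatio ^ i)) := by
    rw [map_ofNat]
    linear_combination (-cubicRatio ^ i) * X_mul_multK
  rw [e, trisect_dilate_mul (by norm_num), trisect_two_X_mul] at h
  push_cast
  linear_combination h

theorem trisect_two_multG_zero : trisect 2 multG ∈ ratioSpan (81 * multK) := by
  have h := trisect_dilate_mul_ratio (j := 2) (by norm_num) (euler ℤ ^ 5) 4 0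
  simp only [pow_zero, mul_one, mul_zero, add_zero, ← multG_eq] at h
  -- In aQ⁴ the monomials of y-degree 2 mod 3 have coefficients 18, 54 and 9. This common 9,
  -- together with the 9 in c², gives 81. Constants appear as `dilate` of themselves so that
  -- `trisect_dilate_mul` extracts them.
  set F : ℤ⟦X⟧ := 2 * (thetaX ^ 7 * thetaY ^ 2) + 6 * (thetaX ^ 4 * thetaY ^ 5)
    + thetaX ^ 1 * thetaY ^ 8 with hFdef
  have hF : F ∈ thetaForm (3 * 2 + 3) :=
    add_mem (add_mem (intCast_mul_mem 2 (monomial_mem_thetaForm 7 2))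
      (intCast_mul_mem 6 (monomial_mem_thetaForm 4 5))) (monomial_mem_thetaForm 1 8)
  have hQ : hexTheta ℤ * thetaQ ^ 4 = dilate 9 * F + (thetaX ^ 9 * thetaY ^ 0
      + dilate 6 * (thetaX ^ 8 * thetaY ^ 1) + dilate 36 * (thetaX ^ 6 * thetaY ^ 3)
      + dilate 51 * (thetaX ^ 5 * thetaY ^ 4) + dilate 42 * (thetaX ^ 3 * thetaY ^ 6)
      + dilate 24 * (thetaX ^ 2 * thetaY ^ 7) + dilate 2 * (thetaX ^ 0 * thetaY ^ 9)) := by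
    rw [hFdef, hexTheta_eq, thetaQ]
    simp only [map_ofNat]
    ring
  obtain ⟨p, hp, h2⟩ := mem_ratioSpan.1 (trisect_two_form hF)
  rw [h, hQ]
  simp only [map_add, trisect_dilate_mul (show 2 < 3 by norm_num),
    trisect_thetaX_mul_thetaY (show 2 < 3 by norm_num), ← h2]
  norm_num
  refine mem_ratioSpan.2 ⟨p, hp, ?_⟩
  rw [multK, hexCosetTheta_eq]
  linear_combination (-81 * euler ℤ ^ 5 * coreSeries ^ 2 * hexTheta ℤ * borweinBInv ^ 6 * p)
    * borweinB_pow_mul_inv_pow 6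

theorem trisect_two_of_mem_multG {F : ℤ⟦X⟧} (hF : F ∈ ratioSpan multG) :
    trisect 2 F ∈ ratioSpan (81 * multK) := by
  refine map_mem_of_ratioSpan _ _ (fun i => ?_) hF
  rcases i with _ | i
  · rw [pow_zero, mul_one]
    exact trisect_two_multG_zero
  · have h := trisect_two_mem (euler ℤ ^ 5) 1 (i + 1)
    have e : (9 : ℤ⟦X⟧) ^ (i + 1 + 1) = 81 * ((9 ^ i : ℤ) : ℤ⟦X⟧) := by push_cast; ring
    have e2 : multG * cubicRatio ^ (i + 1) = dilate (euler ℤ ^ 5)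
        * (hexTheta ℤ * borweinBInv ^ (3 * 1 + 1) * cubicRatio ^ (i + 1)) := by
      rw [multG_eq]
      ring
    rw [e, ← e2] at h
    exact ratioSpan_mul_le _ _ _ h

theorem nine_dvd_of_ratioSpan (L : ℤ⟦X⟧ →+ ℤ⟦X⟧) {G : ℤ⟦X⟧}
    (h : ∀ i, 9 ∣ L (G * cubicRatio ^ i)) {F : ℤ⟦X⟧} (hF : F ∈ ratioSpan G) : 9 ∣ L F :=
  Ideal.mem_span_singleton.1 (map_mem_of_ratioSpan L (Ideal.span {(9 : ℤ⟦X⟧)}).toAddSubgroup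
    (fun i => Ideal.mem_span_singleton.2 (h i)) hF)

theorem nine_dvd_trisect_two_of_mem_multK {F : ℤ⟦X⟧} (hF : F ∈ ratioSpan multK) :
    9 ∣ trisect 2 F := by
  refine nine_dvd_of_ratioSpan _ (fun i => ?_) hF
  rw [multK_eq, mul_assoc, trisect_dilate_mul_ratio (by norm_num)]
  exact (nine_dvd_trisect_two_form (hexTheta_mul_form_mem _ _)).mul_left _

theorem nine_dvd_trisect_one_of_mem_multG {F : ℤ⟦X⟧} (hF : F ∈ ratioSpan multG) :
    9 ∣ trisect 1 F := by
  refine nine_dvd_of_ratioSpan _ (fun i => ?_) hF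
  rw [multG_eq, mul_assoc, trisect_dilate_mul_ratio (by norm_num)]
  rcases i with _ | i
  -- Without r, the monomials of y-degree 1 mod 3 in aQ⁴ have coefficients 6, 51 and 24; each
  -- supplies a 3, and c supplies another.
  · refine Dvd.dvd.mul_left ?_ _
    have hQ : hexTheta ℤ * (thetaQ ^ (4 + 4 * 0) * thetaY ^ 0) = dilate 9 * (2 * (thetaX ^ 7
        * thetaY ^ 2) + 6 * (thetaX ^ 4 * thetaY ^ 5) + thetaX ^ 1 * thetaY ^ 8)
        + (thetaX ^ 9 * thetaY ^ 0
        + dilate 6 * (thetaX ^ 8 * thetaY ^ 1) + dilate 36 * (thetaX ^ 6 * thetaY ^ 3)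
        + dilate 51 * (thetaX ^ 5 * thetaY ^ 4) + dilate 42 * (thetaX ^ 3 * thetaY ^ 6)
        + dilate 24 * (thetaX ^ 2 * thetaY ^ 7) + dilate 2 * (thetaX ^ 0 * thetaY ^ 9)) := by
      rw [hexTheta_eq, thetaQ]
      simp only [map_ofNat]
      ring
    rw [hQ, map_add, trisect_dilate_mul (by norm_num)]
    refine (dvd_mul_right _ _).add ?_
    simp only [map_add, trisect_dilate_mul (show 1 < 3 by norm_num),
      trisect_thetaX_mul_thetaY (show 1 < 3 by norm_num)]
    norm_num
    rw [hexCosetTheta_eq]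
    exact ⟨2 * hexTheta ℤ ^ 8 * coreSeries + 459 * hexTheta ℤ ^ 5 * coreSeries ^ 4 * X
      + 5832 * hexTheta ℤ ^ 2 * coreSeries ^ 7 * X ^ 2, by ring⟩
  · refine Dvd.dvd.mul_right (Dvd.dvd.mul_left ?_ _) _
    exact dvd_pow_self _ i.succ_ne_zero

/-- The constant term of θ⁹ equals a³x + 18yQ(a + y), a quartic form, and ∏(1 - qⁱ)⁻⁹ is Q³ times a
series in q³. The product has degree 10, so its class 0 mod 3 is a b⁹ times a polynomial in r, and
b⁹ cancels. -/
theorem trisect_zero_cphiSeries : trisect 0 (cphiSeries 9) ∈ ratioSpan multH := by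
  have h := euler_pow_mul_cphiSeries 9
  rw [constTerm_theta_pow_nine] at h
  set θ : ℤ⟦X⟧ := (hexTheta ℤ ^ 3 * thetaX + ((18 : ℤ) : ℤ⟦X⟧)
    * (thetaY * thetaQ * (hexTheta ℤ + thetaY))) * thetaQ ^ 3 with hθ
  have hy : hexTheta ℤ + thetaY ∈ thetaForm 1 := add_mem hexTheta_mem thetaY_mem
  have hmem : θ ∈ thetaForm (3 * 3 + 1) := by
    refine thetaForm_mul (m := 4) (n := 6) (add_mem ?_ (intCast_mul_mem 18 ?_))
      (thetaForm_pow thetaQ_mem 3)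
    · exact thetaForm_mul (m := 3) (n := 1) (thetaForm_pow hexTheta_mem 3) thetaX_mem
    · exact thetaForm_mul (m := 3) (n := 1)
        (thetaForm_mul (m := 1) (n := 2) thetaY_mem thetaQ_mem) hy
  have hE := euler_pow_mul_eulerInv_pow 9
  have hi : eulerInv ^ 9 = dilate (eulerInv ^ 3 * borweinBInv ^ 9) * thetaQ ^ 3 := by
    have h1 : eulerInv ^ 3 = dilate eulerInv * borweinBInv := by
      rw [borweinBInv]
      linear_combination (-eulerInv ^ 3) * dilate_euler_mul_eulerInv
    have h2 : borweinBInv ^ 3 = (thetaQ * dilate borweinBInv ^ 3) ^ 3 := by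
      conv_lhs => rw [borweinBInv_eq]
    have h3 : eulerInv ^ 9 = (eulerInv ^ 3) ^ 3 := by ring
    rw [map_mul, map_pow, map_pow, h3, h1, mul_pow, h2]
    ring
  have hc : cphiSeries 9 = dilate (eulerInv ^ 3 * borweinBInv ^ 9) * θ := by
    have hX : X * hexCosetTheta ℤ ^ 3 = 9 * thetaY * thetaQ := by
      rw [hexCosetTheta_eq]
      linear_combination mul_coreSeries_pow_three
    have h' : euler ℤ ^ 9 * cphiSeries 9 = hexTheta ℤ ^ 3 * thetaX
        + 18 * (thetaY * thetaQ * (hexTheta ℤ + thetaY)) := by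
      rw [h, dilate_hexTheta, thetaY] at *
      linear_combination (2 * hexTheta ℤ + 2 * X * dilate (hexCosetTheta ℤ)) * hX
    rw [hθ]
    push_cast
    linear_combination eulerInv ^ 9 * h' - cphiSeries 9 * hE
      + (hexTheta ℤ ^ 3 * thetaX + 18 * (thetaY * thetaQ * (hexTheta ℤ + thetaY))) * hi
  rw [hc, trisect_dilate_mul (by norm_num)]
  obtain ⟨p, hp, h2⟩ := mem_ratioSpan.1 (trisect_zero_form hmem)
  rw [← h2]
  refine mem_ratioSpan.2 ⟨p, hp, ?_⟩
  rw [multH]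
  linear_combination (-hexTheta ℤ * eulerInv ^ 3 * p) * borweinB_pow_mul_inv_pow 9

end hecke

/-! ### Iteration along the arithmetic progressions -/

section progressions

/-- The values of `cphi 9` on the progression for odd powers of three. -/
noncomputable def cphiOdd (k : ℕ) : ℤ⟦X⟧ :=
  PowerSeries.mk fun n => (cphi 9 (3 ^ (2 * k + 1) * n + (7 * 3 ^ (2 * k + 1) + 3) / 8) : ℤ)

/-- The values of `cphi 9` on the progression for even powers of three. -/
noncomputable def cphiEven (k : ℕ) : ℤ⟦X⟧ :=
  PowerSeries.mk fun n => (cphi 9 (3 ^ (2 * k + 2) * n + (5 * 3 ^ (2 * k + 2) + 3) / 8) : ℤ)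

theorem three_pow_two_mul_succ_mod_eight (k : ℕ) : 3 ^ (2 * k + 1) % 8 = 3 := by
  rw [pow_succ, pow_mul, Nat.mul_mod, Nat.pow_mod]
  norm_num

theorem cphiEven_zero : cphiEven 0 = trisect 2 (trisect 0 (cphiSeries 9)) := by
  ext n
  rw [coeff_trisect, coeff_trisect, cphiEven, cphiSeries, coeff_mk, coeff_mk]
  norm_num
  congr 1
  ring

theorem cphiOdd_succ (k : ℕ) : cphiOdd (k + 1) = trisect 2 (cphiEven k) := by
  ext n
  rw [coeff_trisect, cphiEven, cphiOdd, coeff_mk, coeff_mk]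
  have h := three_pow_two_mul_succ_mod_eight k
  have e1 : 3 ^ (2 * k + 2) = 3 * 3 ^ (2 * k + 1) := by ring
  have e2 : 3 ^ (2 * (k + 1) + 1) = 9 * 3 ^ (2 * k + 1) := by ring
  rw [e1, e2]
  congr 2
  generalize 3 ^ (2 * k + 1) = m at h
  have e3 : 9 * m * n = 9 * (m * n) := by ring
  have e4 : 3 * m * (3 * n + 2) = 9 * (m * n) + 6 * m := by ring
  rw [e3, e4]
  omega

theorem cphiEven_eq (k : ℕ) : cphiEven k = trisect 1 (cphiOdd k) := by
  ext n
  rw [coeff_trisect, cphiEven, cphiOdd, coeff_mk, coeff_mk]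
  have h := three_pow_two_mul_succ_mod_eight k
  have e1 : 3 ^ (2 * k + 2) = 3 * 3 ^ (2 * k + 1) := by ring
  rw [e1]
  congr 2
  generalize 3 ^ (2 * k + 1) = m at h
  have e3 : 3 * m * n = 3 * (m * n) := by ring
  have e4 : m * (3 * n + 1) = 3 * (m * n) + m := by ring
  rw [e3, e4]
  omega

theorem map_mem_ratioSpan (j : ℕ) {F G G' : ℤ⟦X⟧} (c d : ℕ)
    (h : ∀ F ∈ ratioSpan G, trisect j F ∈ ratioSpan (d * G'))
    (hF : ∃ H ∈ ratioSpan G, F = c * H) : ∃ H ∈ ratioSpan G', trisect j F = (c * d : ℕ) * H := by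
  obtain ⟨H, hH, rfl⟩ := hF
  obtain ⟨p, hp, hp'⟩ := mem_ratioSpan.1 (h H hH)
  refine ⟨G' * p, mem_ratioSpan.2 ⟨p, hp, rfl⟩, ?_⟩
  rw [← nsmul_eq_mul, map_nsmul, ← hp', nsmul_eq_mul]
  push_cast
  ring

/-- The initial 3³ comes from H → G, and each turn G → K → G multiplies by 81 · 3 = 3⁵. -/
theorem cphiEven_mem (k : ℕ) :
    ∃ H ∈ ratioSpan multG, cphiEven k = (3 ^ (5 * k + 3) : ℕ) * H := by
  induction k with
  | zero =>
    rw [cphiEven_zero]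
    have h := map_mem_ratioSpan 2 (F := trisect 0 (cphiSeries 9)) (G := multH) (G' := multG) 1 27
      (fun F hF => by exact_mod_cast trisect_two_of_mem_multH hF)
      ⟨_, trisect_zero_cphiSeries, by simp⟩
    exact h
  | succ k ih =>
    have h1 := map_mem_ratioSpan 2 (G' := multK) _ 81
      (fun F hF => by exact_mod_cast trisect_two_of_mem_multG hF) ih
    have h2 := map_mem_ratioSpan 1 (G' := multG) _ 3
      (fun F hF => by exact_mod_cast trisect_one_of_mem_multK hF) h1
    rw [cphiEven_eq, cphiOdd_succ]
    have e : 3 ^ (5 * (k + 1) + 3) = 3 ^ (5 * k + 3) * 81 * 3 := by ring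
    rw [e]
    exact h2

theorem cphiOdd_mem (k : ℕ) :
    ∃ H ∈ ratioSpan multK, cphiOdd (k + 1) = (3 ^ (5 * k + 7) : ℕ) * H := by
  have h1 := map_mem_ratioSpan 2 (G' := multK) _ 81
    (fun F hF => by exact_mod_cast trisect_two_of_mem_multG hF) (cphiEven_mem k)
  rw [cphiOdd_succ]
  have e : 3 ^ (5 * k + 7) = 3 ^ (5 * k + 3) * 81 := by ring
  rw [e]
  exact h1

theorem pow_dvd_coeff {a b : ℕ} {F H : ℤ⟦X⟧} (h : F = (3 ^ a : ℕ) * H) (hab : b ≤ a) (n : ℕ) :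
    ((3 ^ b : ℕ) : ℤ) ∣ coeff n F := by
  rw [h, ← nsmul_eq_mul, map_nsmul, nsmul_eq_mul]
  exact (Int.natCast_dvd_natCast.2 (pow_dvd_pow 3 hab)).mul_right _

theorem pow_dvd_coeff_trisect {a b j : ℕ} {F H : ℤ⟦X⟧} (h : F = (3 ^ a : ℕ) * H)
    (h9 : 9 ∣ trisect j H) (hab : b ≤ a + 2) (n : ℕ) :
    ((3 ^ b : ℕ) : ℤ) ∣ coeff (3 * n + j) F := by
  obtain ⟨H', hH'⟩ := h9
  rw [← coeff_trisect]
  refine pow_dvd_coeff (a := a + 2) (H := H') ?_ hab n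
  rw [h, ← nsmul_eq_mul, map_nsmul, hH', nsmul_eq_mul]
  push_cast
  ring

end progressions

theorem theorem4 (k n : ℕ) (hk : 3 ≤ k) :
    cphi 9 (3 ^ (2 * k + 1) * n + (7 * 3 ^ (2 * k + 1) + 3) / 8) ≡ 0 [MOD 3 ^ (4 * k + 5)] ∧
    cphi 9 (3 ^ (2 * k + 2) * n + (5 * 3 ^ (2 * k + 2) + 3) / 8) ≡ 0 [MOD 3 ^ (4 * k + 6)] ∧
    cphi 9 (3 ^ (2 * k + 2) * n + (23 * 3 ^ (2 * k + 1) + 3) / 8) ≡ 0 [MOD 3 ^ (4 * k + 7)] ∧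
    cphi 9 (3 ^ (2 * k + 3) * n + (13 * 3 ^ (2 * k + 2) + 3) / 8) ≡ 0 [MOD 3 ^ (4 * k + 8)] := by
  obtain ⟨G, hG, hE⟩ := cphiEven_mem k
  -- The available exponents are 5k + 2, 5k + 3, 5k + 4 and 5k + 5, the last two including the extra
  -- 9; each reaches the required 4k + 5, …, 4k + 8 exactly when k ≥ 3.
  obtain ⟨l, rfl⟩ : ∃ l, k = l + 1 := ⟨k - 1, by omega⟩
  obtain ⟨K, hK, hO⟩ := cphiOdd_mem l
  have hm := three_pow_two_mul_succ_mod_eight (l + 1)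
  have e2 : 3 ^ (2 * (l + 1) + 2) = 3 * 3 ^ (2 * (l + 1) + 1) := by ring
  have e3 : 3 ^ (2 * (l + 1) + 3) = 9 * 3 ^ (2 * (l + 1) + 1) := by ring
  refine ⟨?_, ?_, ?_, ?_⟩ <;> rw [Nat.modEq_zero_iff_dvd, ← Int.natCast_dvd_natCast]
  · have h := pow_dvd_coeff (b := 4 * (l + 1) + 5) hO (by omega) n
    rwa [cphiOdd, coeff_mk] at h
  · have h := pow_dvd_coeff (b := 4 * (l + 1) + 6) hE (by omega) n
    rwa [cphiEven, coeff_mk] at h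
  · have h := pow_dvd_coeff_trisect (b := 4 * (l + 1) + 7) hO
      (nine_dvd_trisect_two_of_mem_multK hK) (by omega) n
    rw [cphiOdd, coeff_mk] at h
    convert h using 3
    rw [e2]
    generalize 3 ^ (2 * (l + 1) + 1) = m at hm
    have h1 : 3 * m * n = 3 * (m * n) := by ring
    have h2 : m * (3 * n + 2) = 3 * (m * n) + 2 * m := by ring
    rw [h1, h2]
    omega
  · have h := pow_dvd_coeff_trisect (b := 4 * (l + 1) + 8) hE
      (nine_dvd_trisect_one_of_mem_multG hG) (by omega) n
    rw [cphiEven, coeff_mk] at h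
    convert h using 3
    rw [e2, e3]
    generalize 3 ^ (2 * (l + 1) + 1) = m at hm
    have h1 : 9 * m * n = 9 * (m * n) := by ring
    have h2 : 3 * m * (3 * n + 1) = 9 * (m * n) + 3 * m := by ring
    rw [h1, h2]
    omega
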